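/- **Setting.** Let $\tau>0$, let $X$ be a complex Banach space and $U_0,U_{d0},Y_0$ complex Hilbert spaces, and write $U=L^2(0,\tau;U_0)$, $U_d=L^2(0,\tau;U_{d0})$, $Y=L^2(0,\tau;Y_0)$. A $\tau$-periodic system $\dot x=A(t)x+B(t)u+B_d(t)w$, $y=C(t)x+D(t)u$ is given by a strongly continuous evolution family $U_A(t,s)\in\mathcal L(X)$, $t\ge s$, with $U_A(t,t)=I$, $U_A(t,r)U_A(r,s)=U_A(t,s)$ for $t\ge r\ge s$ and $U_A(t+\tau,s+\tau)=U_A(t,s)$, and by $\tau$-periodic $B\in L^\infty(\mathbb R,\mathcal L(U_0,X))$, $B_d\in L^\infty(\mathbb R,\mathcal L(U_{d0},X))$, $C\in L^\infty(\mathbb R,\mathcal L(X,Y_0))$, $D\in L^\infty(\mathbb R,\mathcal L(U_0,Y_0))$. Its mild state is $$x(t)=U_A(t,0)x_0+\int_0^tU_A(t,s)\bigl(B(s)u(s)+B_d(s)w(s)\bigr)\,ds .$$ It is exponentially stable if $\|U_A(t,s)\|\le Me^{-\omega(t-s)}$ for all $t\ge s$ and some $M,\omega>0$. If $1\in\rho(U_A(\tau,0))$,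 put $G_A(t,s)=U_A(t,0)(I-U_A(\tau,0))^{-1}U_A(\tau,s)$ and define $\mathcal P\in\mathcal L(U,Y)$, $\mathcal P_d\in\mathcal L(U_d,Y)$ by $$\mathcal Pu=C(\cdot)\int_0^\tau G_A(\cdot,s)B(s)u(s)\,ds+C(\cdot)\int_0^{\,\cdot}U_A(\cdot,s)B(s)u(s)\,ds+D(\cdot)u(\cdot),$$ $$\mathcal P_dw=C(\cdot)\int_0^\tau G_A(\cdot,s)B_d(s)w(s)\,ds+C(\cdot)\int_0^{\,\cdot}U_A(\cdot,s)B_d(s)w(s)\,ds .$$ For $G_1\in\mathcal L(Z)$, $G_2\in\mathcal L(Y,Z)$, $K\in\mathcal L(Z,U)$, the controller $(G_1,G_2,K)$ on $Z$ is $$z_{n+1}=G_1z_n+G_2e_n,\qquad u(n\tau+\cdot)=Kz_n\ \text{ on } [0,\tau),\qquad e_n=y(n\tau+\cdot)-y_{ref}(\cdot)\in Y,\qquad n\ge0,$$ with initial state $z_0\in Z$. The reference $y_{ref}$ and the disturbance $w=w_{dist}$ are $\tau$-periodic and are identified with elements of $Y$ and $U_d$. The closed loop is exponentially stable if there are $M_0,M_1,\alpha_0,\alpha_1>0$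 such that, for $y_{ref}=0$ and $w_{dist}=0$, $\|x(t)\|\le M_0e^{-\alpha_0t}(\|x_0\|+\|z_0\|)$ and $\|z_n\|\le M_1e^{-\alpha_1n}(\|x_0\|+\|z_0\|)$ for all $t\ge0$, $n\ge0$, $x_0\in X$, $z_0\in Z$. We say that the regulation error converges to $e_\infty(y_{ref},w_{dist})\in Y$ if there are $M,\alpha>0$ with $$\|e_n-e_\infty(y_{ref},w_{dist})\|_Y\le Me^{-\alpha n}\bigl(\|x_0\|+\|z_0\|+\|y_{ref}\|_Y+\|w_{dist}\|_{U_d}\bigr)$$ for all $n\ge0$, all $x_0\in X$, $z_0\in Z$ and all $\tau$-periodic signals $y_{ref}\in Y$, $w_{dist}\in U_d$; in particular then $\|y(n\tau+\cdot)-y_{ref}(\cdot)\|_Y\to\|e_\infty(y_{ref},w_{dist})\|_Y$ as $n\to\infty$. **Theorem.** Assume that the periodic system is exponentially stable. Let $Y_N\subset Y$ be a finite-dimensional subspace with $Y_N\subset\operatorname{ran}(\mathcal P)$, let $r=\dim Y_N$, and let $Q_N$ be a bounded projection of $Y$ onto $Y_N$. Let $G_{20}\in\mathcal L(Y_N,\mathbb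 C^r)$ be boundedly invertible, and let $K_0\in\mathcal L(\mathbb C^r,U)$ be such that $\sigma(G_{20}Q_N\mathcal PK_0)\subset\mathbb C_-=\{\lambda:\operatorname{Re}\lambda<0\}$. On $Z=\mathbb C^r$ consider the controller $$G_1=I,\qquad G_2=G_{20}Q_N,\qquad K=\varepsilon K_0 .$$ Then there is $\varepsilon^*>0$ such that for every $0<\varepsilon\le\varepsilon^*$ the following hold. 1. For all initial states and all $\tau$-periodic $y_{ref}\in Y$, $w_{dist}\in U_d$ the closed-loop system has a trajectory. The closed loop is exponentially stable. For all such signals the equation $Q_N\mathcal PKz=Q_Ny_{ref}-Q_N\mathcal P_dw_{dist}$ has a unique solution $z\in Z$, and the regulation error converges to $$(I-Q_N)\bigl[\mathcal PKz+\mathcal P_dw_{dist}-y_{ref}\bigr].$$ 2. (Robustness.) Suppose that the system is replaced by any $\tau$-periodic system of the above form, with the same spaces $X,U_0,U_{d0},Y_0$, for which the closed loop with the same controller is exponentially stable. Then for all initial states and all $\tau$-periodic signals the perturbed closed loop has a trajectory, and its regulation error converges to some $e_\infty(y_{ref},w_{dist})$ with $Q_Ne_\infty(y_{ref},w_{dist})=0$.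 If moreover $1\in\rho(U_{\tilde A}(\tau,0))$ for the perturbed evolution family, then the assertions of part 1 on the unique solution $z$ and on the limit of the regulation error hold with $\mathcal P,\mathcal P_d$ replaced by the operators $\tilde{\mathcal P},\tilde{\mathcal P}_d$ of the perturbed system. -/

import Mathlib

open MeasureTheory Set Filter Topology
open scoped ENNReal

noncomputable section

/-- Lebesgue measure on one period `(0, τ]` (the end points are null sets). -/
abbrev periodMeasure (τ : ℝ) : Measure ℝ := volume.restrict (Ioc 0 τ)

/-- The space `L²(0, τ; V)`. -/
abbrev L2 (τ : ℝ) (V : Type*) [NormedAddCommGroup V] := Lp V 2 (periodMeasure τ)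

/-- A strongly continuous evolution family `U(t,s)`, `t ≥ s`, of bounded operators on `X` that is
`τ`-periodic: `U(t+τ,s+τ) = U(t,s)`.  Only the values at `s ≤ t` matter. -/
structure PeriodicEvolutionFamily (τ : ℝ) (X : Type*) [NormedAddCommGroup X]
    [NormedSpace ℂ X] where
  period_pos : 0 < τ
  evol : ℝ → ℝ → X →L[ℂ] X
  evol_self : ∀ t, evol t t = ContinuousLinearMap.id ℂ X
  evol_comp : ∀ t r s, s ≤ r → r ≤ t → evol t r ∘L evol r s = evol t s
  evol_cont : ∀ x : X, ContinuousOn (fun p : ℝ × ℝ => evol p.1 p.2 x) {p | p.2 ≤ p.1}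
  evol_periodic : ∀ t s, s ≤ t → evol (t + τ) (s + τ) = evol t s

namespace PeriodicEvolutionFamily

variable {τ : ℝ} {X : Type*} [NormedAddCommGroup X] [NormedSpace ℂ X]

/-- Exponential stability: `‖U(t,s)‖ ≤ M e^{-ω (t-s)}` for all `t ≥ s`. -/
def ExponentiallyStable (E : PeriodicEvolutionFamily τ X) : Prop :=
  ∃ M > 0, ∃ ω > 0, ∀ t s, s ≤ t → ‖E.evol t s‖ ≤ M * Real.exp (-ω * (t - s))

/-- `(I - U(τ,0))⁻¹`, meaningful when `1` lies in the resolvent set of `U(τ,0)`. -/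
def monodromyResolvent (E : PeriodicEvolutionFamily τ X) : X →L[ℂ] X :=
  Ring.inverse (ContinuousLinearMap.id ℂ X - E.evol τ 0)

/-- The kernel `G(t,s) = U(t,0) (I - U(τ,0))⁻¹ U(τ,s)`. -/
def green (E : PeriodicEvolutionFamily τ X) (t s : ℝ) : X →L[ℂ] X :=
  E.evol t 0 ∘L E.monodromyResolvent ∘L E.evol τ s

/-- `∫₀^τ G(t,s) g(s) ds + ∫₀ᵗ U(t,s) g(s) ds`. -/
def steadyState (E : PeriodicEvolutionFamily τ X) (g : ℝ → X) (t : ℝ) : X :=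
  (∫ s in (0 : ℝ)..τ, E.green t s (g s)) + ∫ s in (0 : ℝ)..t, E.evol t s (g s)

/-! The map `g ↦ steadyState g` is a bounded operator on `L²(0, τ; X)`. -/

theorem exists_bound [CompleteSpace X] (E : PeriodicEvolutionFamily τ X) :
    ∃ M : NNReal, ∀ t s, 0 ≤ s → s ≤ t → t ≤ τ → ‖E.evol t s‖ ≤ M := by
  let S : Set (ℝ × ℝ) := {p | 0 ≤ p.2 ∧ p.2 ≤ p.1 ∧ p.1 ≤ τ}
  have hS : IsCompact S := by
    refine (isCompact_Icc (a := ((0, 0) : ℝ × ℝ)) (b := (τ, τ))).of_isClosed_subset ?_ ?_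
    · exact (isClosed_le continuous_const continuous_snd).inter
        ((isClosed_le continuous_snd continuous_fst).inter
          (isClosed_le continuous_fst continuous_const))
    · rintro ⟨t, s⟩ ⟨h1, h2, h3⟩
      simp only at h1 h2 h3
      exact ⟨⟨h1.trans h2, h1⟩, ⟨h3, h2.trans h3⟩⟩
  obtain ⟨C, hC⟩ := banach_steinhaus (g := fun p : S => E.evol p.1.1 p.1.2) (fun x => by
    obtain ⟨C, hC⟩ := hS.exists_bound_of_continuousOn
      ((E.evol_cont x).mono (fun p hp => hp.2.1))
    exact ⟨C, fun p => hC p.1 p.2⟩)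
  exact ⟨C.toNNReal, fun t s h0 hs ht =>
    (hC ⟨(t, s), h0, hs, ht⟩).trans (Real.le_coe_toNNReal C)⟩

/-- The evolution family on `0 ≤ s ≤ t ≤ τ`, extended continuously to all `(t, s)`. -/
def clamped (E : PeriodicEvolutionFamily τ X) (q : (ℝ × ℝ) × X) : X :=
  E.evol (max 0 (min q.1.1 τ)) (min (max 0 (min q.1.2 τ)) (max 0 (min q.1.1 τ))) q.2

theorem clamped_eq (E : PeriodicEvolutionFamily τ X) {t s : ℝ} (h0 : 0 ≤ s) (hs : s ≤ t)
    (ht : t ≤ τ) (x : X) : E.clamped ((t, s), x) = E.evol t s x := by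
  simp [clamped, min_eq_left ht, min_eq_left (hs.trans ht), max_eq_right h0,
    max_eq_right (h0.trans hs), min_eq_left hs]

theorem continuous_clamped [CompleteSpace X] (E : PeriodicEvolutionFamily τ X) :
    Continuous E.clamped := by
  obtain ⟨M, hM⟩ := E.exists_bound
  refine continuous_prod_of_continuous_lipschitzWith' _ M (fun p => ?_) (fun x => ?_)
  · refine LipschitzWith.of_dist_le_mul fun x y => ?_
    simp only [clamped, dist_eq_norm, ← map_sub]
    refine (ContinuousLinearMap.le_opNorm _ _).trans ?_
    gcongr
    exact hM _ _ (le_min (le_max_left _ _) (le_max_left _ _)) (min_le_right _ _)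
      (max_le E.period_pos.le (min_le_right _ _))
  · have h : Continuous fun p : ℝ × ℝ =>
        (max 0 (min p.1 τ), min (max 0 (min p.2 τ)) (max 0 (min p.1 τ))) := by fun_prop
    have h' : ∀ p : ℝ × ℝ,
        min (max 0 (min p.2 τ)) (max 0 (min p.1 τ)) ≤ max 0 (min p.1 τ) :=
      fun p => min_le_right _ _
    exact (E.evol_cont x).comp_continuous h h'

/-- The combined kernel of the two integrals in `steadyState`. -/
def kernel (E : PeriodicEvolutionFamily τ X) (t s : ℝ) (x : X) : X :=
  E.green t s x + if s ≤ t then E.evol t s x else 0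

theorem kernel_bound [CompleteSpace X] (E : PeriodicEvolutionFamily τ X) :
    ∃ M : ℝ, 0 ≤ M ∧ ∀ t ∈ Ioc 0 τ, ∀ s ∈ Ioc 0 τ, ∀ x, ‖E.kernel t s x‖ ≤ M * ‖x‖ := by
  obtain ⟨M, hM⟩ := E.exists_bound
  refine ⟨M * (‖E.monodromyResolvent‖ * M) + M, by positivity, fun t ht s hs x => ?_⟩
  rw [add_mul]
  refine (norm_add_le _ _).trans (add_le_add ?_ ?_)
  · refine ContinuousLinearMap.le_of_opNorm_le _ ?_ _
    refine (ContinuousLinearMap.opNorm_comp_le _ _).trans ?_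
    gcongr
    · exact hM _ _ le_rfl ht.1.le ht.2
    · refine (ContinuousLinearMap.opNorm_comp_le _ _).trans ?_
      gcongr
      exact hM _ _ hs.1.le hs.2 le_rfl
  · split_ifs with h
    · exact ContinuousLinearMap.le_of_opNorm_le _ (hM _ _ hs.1.le h ht.2) _
    · simp; positivity

theorem green_eq (E : PeriodicEvolutionFamily τ X) {t s : ℝ} (ht : t ∈ Ioc 0 τ)
    (hs : s ∈ Ioc 0 τ) (x : X) : E.green t s x =
      E.clamped ((t, 0), E.monodromyResolvent (E.clamped ((τ, s), x))) := by
  rw [E.clamped_eq le_rfl ht.1.le ht.2, E.clamped_eq hs.1.le hs.2 le_rfl]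
  rfl

theorem aestronglyMeasurable_green [CompleteSpace X] (E : PeriodicEvolutionFamily τ X) {g : ℝ → X}
    (hg : AEStronglyMeasurable g (periodMeasure τ)) {t : ℝ} (ht : t ∈ Ioc 0 τ) :
    AEStronglyMeasurable (fun s => E.green t s (g s)) (periodMeasure τ) := by
  have hc := E.continuous_clamped
  have h1 : Continuous fun q : ℝ × X =>
      E.clamped ((t, 0), E.monodromyResolvent (E.clamped ((τ, q.1), q.2))) := by fun_prop
  have h2 := h1.comp_aestronglyMeasurable (aestronglyMeasurable_id.prodMk hg)
  refine h2.congr ?_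
  filter_upwards [ae_restrict_mem measurableSet_Ioc] with s hs
  exact (E.green_eq ht hs _).symm

theorem aestronglyMeasurable_evol [CompleteSpace X] (E : PeriodicEvolutionFamily τ X) {g : ℝ → X}
    (hg : AEStronglyMeasurable g (periodMeasure τ)) {t : ℝ} (ht : t ∈ Ioc 0 τ) :
    AEStronglyMeasurable (fun s => if s ≤ t then E.evol t s (g s) else 0) (periodMeasure τ) := by
  have hc := E.continuous_clamped
  have h1 : Continuous fun q : ℝ × X => E.clamped ((t, q.1), q.2) := by fun_prop
  have h2 := h1.comp_aestronglyMeasurable (aestronglyMeasurable_id.prodMk hg)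
  refine (h2.indicator (measurableSet_Iic (a := t))).congr ?_
  filter_upwards [ae_restrict_mem measurableSet_Ioc] with s hs
  by_cases h : s ≤ t
  · simp [h, E.clamped_eq hs.1.le h ht.2]
  · simp [h]

theorem aestronglyMeasurable_kernel_prod [CompleteSpace X] (E : PeriodicEvolutionFamily τ X)
    {g : ℝ → X} (hg : AEStronglyMeasurable g (periodMeasure τ)) :
    AEStronglyMeasurable (fun p : ℝ × ℝ => E.kernel p.1 p.2 (g p.2))
      ((periodMeasure τ).prod (periodMeasure τ)) := by
  have hc := E.continuous_clamped
  have h0 : AEStronglyMeasurable (fun p : ℝ × ℝ => (p, g p.2))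
      ((periodMeasure τ).prod (periodMeasure τ)) := aestronglyMeasurable_id.prodMk hg.comp_snd
  have h1 : Continuous fun q : (ℝ × ℝ) × X =>
      E.clamped ((q.1.1, 0), E.monodromyResolvent (E.clamped ((τ, q.1.2), q.2))) := by fun_prop
  have h2 := (h1.comp_aestronglyMeasurable h0).add ((hc.comp_aestronglyMeasurable h0).indicator
    (measurableSet_le measurable_snd measurable_fst))
  refine h2.congr ?_
  rw [Measure.prod_restrict]
  filter_upwards [ae_restrict_mem (measurableSet_Ioc.prod measurableSet_Ioc)] with p hp
  by_cases h : p.2 ≤ p.1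
  · simp [kernel, h, E.green_eq hp.1 hp.2, E.clamped_eq hp.2.1.le h hp.1.2]
  · simp [kernel, h, E.green_eq hp.1 hp.2]

theorem integrable_kernel [CompleteSpace X] (E : PeriodicEvolutionFamily τ X) {g : ℝ → X}
    (hg : Integrable g (periodMeasure τ)) {t : ℝ} (ht : t ∈ Ioc 0 τ) :
    Integrable (fun s => E.kernel t s (g s)) (periodMeasure τ) := by
  obtain ⟨M, -, hM⟩ := E.kernel_bound
  refine (hg.norm.const_mul M).mono' ((E.aestronglyMeasurable_green hg.1 ht).add
    (E.aestronglyMeasurable_evol hg.1 ht)) ?_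
  filter_upwards [ae_restrict_mem measurableSet_Ioc] with s hs
  exact hM t ht s hs _

theorem steadyState_eq [CompleteSpace X] (E : PeriodicEvolutionFamily τ X) {g : ℝ → X}
    (hg : Integrable g (periodMeasure τ)) {t : ℝ} (ht : t ∈ Ioc 0 τ) :
    E.steadyState g t = ∫ s, E.kernel t s (g s) ∂(periodMeasure τ) := by
  have hG : Integrable (fun s => E.green t s (g s)) (periodMeasure τ) := by
    obtain ⟨M, hM⟩ := E.exists_bound
    refine (hg.norm.const_mul (M * (‖E.monodromyResolvent‖ * M))).mono'
      (E.aestronglyMeasurable_green hg.1 ht) ?_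
    filter_upwards [ae_restrict_mem measurableSet_Ioc] with s hs
    refine ContinuousLinearMap.le_of_opNorm_le _ ?_ _
    refine (ContinuousLinearMap.opNorm_comp_le _ _).trans ?_
    gcongr
    · exact hM _ _ le_rfl ht.1.le ht.2
    · refine (ContinuousLinearMap.opNorm_comp_le _ _).trans ?_
      gcongr
      exact hM _ _ hs.1.le hs.2 le_rfl
  have hV : Integrable (fun s => if s ≤ t then E.evol t s (g s) else 0) (periodMeasure τ) := by
    have := (E.integrable_kernel hg ht).sub hG
    refine this.congr (ae_of_all _ fun s => ?_)
    simp [kernel]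
  unfold kernel
  rw [integral_add hG hV, steadyState, intervalIntegral.integral_of_le E.period_pos.le,
    intervalIntegral.integral_of_le ht.1.le]
  congr 1
  have : (fun s => if s ≤ t then E.evol t s (g s) else 0) =
      (Iic t).indicator fun s => E.evol t s (g s) := by
    ext s; simp [indicator]
  rw [this, integral_indicator measurableSet_Iic, Measure.restrict_restrict measurableSet_Iic]
  congr 2
  ext s
  simp only [mem_Ioc, mem_inter_iff, mem_Iic]
  constructor
  · rintro ⟨h1, h2⟩; exact ⟨h2, h1, h2.trans ht.2⟩
  · rintro ⟨h1, h2, -⟩; exact ⟨h2, h1⟩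

theorem steadyState_memLp [CompleteSpace X] (E : PeriodicEvolutionFamily τ X) :
    ∃ c : ℝ, 0 ≤ c ∧ ∀ g : L2 τ X, MemLp (E.steadyState g) 2 (periodMeasure τ) ∧
      ∀ t ∈ Ioc 0 τ, ‖E.steadyState g t‖ ≤ c * ‖g‖ := by
  obtain ⟨M, hM0, hM⟩ := E.kernel_bound
  obtain ⟨c, hc0, hc⟩ : ∃ c : ℝ, 0 ≤ c ∧ ∀ g : L2 τ X,
      ∫ s, ‖g s‖ ∂(periodMeasure τ) ≤ c * ‖g‖ := by
    refine ⟨((periodMeasure τ) univ ^ (1 / (1 : ℝ≥0∞).toReal - 1 / (2 : ℝ≥0∞).toReal)).toReal,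
      by positivity, fun g => ?_⟩
    have h := eLpNorm_le_eLpNorm_mul_rpow_measure_univ (μ := periodMeasure τ)
      (p := 1) (q := 2) (by norm_num) (Lp.aestronglyMeasurable g)
    rw [eLpNorm_one_eq_lintegral_enorm] at h
    rw [integral_norm_eq_lintegral_enorm (Lp.aestronglyMeasurable g), Lp.norm_def, mul_comm,
      ← ENNReal.toReal_mul]
    refine ENNReal.toReal_mono (ENNReal.mul_ne_top (Lp.memLp g).2.ne ?_) h
    exact ENNReal.rpow_ne_top_of_nonneg (by norm_num) (measure_ne_top _ _)
  have hbd : ∀ g : L2 τ X, ∀ t ∈ Ioc 0 τ, ‖E.steadyState g t‖ ≤ M * c * ‖g‖ := by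
    intro g t ht
    have hg : Integrable g (periodMeasure τ) := (Lp.memLp g).integrable (by norm_num)
    rw [E.steadyState_eq hg ht]
    refine (norm_integral_le_of_norm_le (hg.norm.const_mul M) ?_).trans ?_
    · filter_upwards [ae_restrict_mem measurableSet_Ioc] with s hs
      exact hM t ht s hs _
    · rw [integral_const_mul, mul_assoc]
      exact mul_le_mul_of_nonneg_left (hc g) hM0
  refine ⟨M * c, by positivity, fun g => ⟨?_, hbd g⟩⟩
  have hg : Integrable g (periodMeasure τ) := (Lp.memLp g).integrable (by norm_num)
  refine MemLp.of_bound ?_ (M * c * ‖g‖) ?_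
  · refine (E.aestronglyMeasurable_kernel_prod hg.1).integral_prod_right'.congr ?_
    filter_upwards [ae_restrict_mem measurableSet_Ioc] with t ht
    exact (E.steadyState_eq hg ht).symm
  · filter_upwards [ae_restrict_mem measurableSet_Ioc] with t ht
    exact hbd g t ht

/-- `g ↦ steadyState g` as a bounded operator on `L²(0, τ; X)`. -/
def steadyStateOp [CompleteSpace X] (E : PeriodicEvolutionFamily τ X) : L2 τ X →L[ℂ] L2 τ X :=
  LinearMap.mkContinuousOfExistsBound
    { toFun := fun g => (E.steadyState_memLp.choose_spec.2 g).1.toLp (E.steadyState g)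
      map_add' := fun f g => by
        rw [← MemLp.toLp_add]
        refine MemLp.toLp_congr _ _ ?_
        filter_upwards [ae_restrict_mem measurableSet_Ioc] with t ht
        have hf : Integrable f (periodMeasure τ) := (Lp.memLp f).integrable (by norm_num)
        have hg : Integrable g (periodMeasure τ) := (Lp.memLp g).integrable (by norm_num)
        have hfg : Integrable (f + g : L2 τ X) (periodMeasure τ) :=
          (Lp.memLp (f + g)).integrable (by norm_num)
        rw [Pi.add_apply, E.steadyState_eq hf ht, E.steadyState_eq hg ht,
          E.steadyState_eq hfg ht,
          ← integral_add (E.integrable_kernel hf ht) (E.integrable_kernel hg ht)]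
        refine integral_congr_ae ?_
        filter_upwards [Lp.coeFn_add f g] with s hs
        rw [hs]
        simp only [kernel, Pi.add_apply, map_add]
        split_ifs <;> abel
      map_smul' := fun a g => by
        rw [RingHom.id_apply, ← MemLp.toLp_const_smul]
        refine MemLp.toLp_congr _ _ ?_
        filter_upwards [ae_restrict_mem measurableSet_Ioc] with t ht
        have hg : Integrable g (periodMeasure τ) := (Lp.memLp g).integrable (by norm_num)
        have hag : Integrable (a • g : L2 τ X) (periodMeasure τ) :=
          (Lp.memLp (a • g)).integrable (by norm_num)
        rw [Pi.smul_apply, E.steadyState_eq hg ht, E.steadyState_eq hag ht, ← integral_smul]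
        refine integral_congr_ae ?_
        filter_upwards [Lp.coeFn_smul a g] with s hs
        rw [hs]
        simp only [kernel, Pi.smul_apply, map_smul, smul_add]
        split_ifs <;> simp }
    (by
      obtain ⟨c, hc0, hc⟩ := E.steadyState_memLp
      refine ⟨measureUnivNNReal (periodMeasure τ) ^ ((2 : ℝ≥0∞).toReal)⁻¹ * c, fun g => ?_⟩
      have h2 := Lp.norm_le_of_ae_bound (p := 2)
        (f := (hc g).1.toLp (E.steadyState g)) (C := c * ‖g‖) (by positivity) (by
          filter_upwards [(hc g).1.coeFn_toLp, ae_restrict_mem measurableSet_Ioc] with t h1 ht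
          rw [h1]; exact (hc g).2 t ht)
      rw [mul_assoc]
      exact h2)

theorem coeFn_steadyStateOp [CompleteSpace X] (E : PeriodicEvolutionFamily τ X) (g : L2 τ X) :
    E.steadyStateOp g =ᵐ[periodMeasure τ] E.steadyState g :=
  MemLp.coeFn_toLp (E.steadyState_memLp.choose_spec.2 g).1

theorem steadyState_congr (E : PeriodicEvolutionFamily τ X) {f g : ℝ → X}
    (h : f =ᵐ[periodMeasure τ] g) {t : ℝ} (ht : t ∈ Ioc 0 τ) :
    E.steadyState f t = E.steadyState g t := by
  rw [Filter.EventuallyEq, ae_restrict_iff' measurableSet_Ioc] at h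
  unfold steadyState
  congr 1
  · refine intervalIntegral.integral_congr_ae ?_
    filter_upwards [h] with s hs hs'
    rw [uIoc_of_le E.period_pos.le] at hs'
    rw [hs hs']
  · refine intervalIntegral.integral_congr_ae ?_
    filter_upwards [h] with s hs hs'
    rw [uIoc_of_le ht.1.le] at hs'
    rw [hs ⟨hs'.1, hs'.2.trans ht.2⟩]

end PeriodicEvolutionFamily

/-- Pointwise multiplication `(b u)(t) = b(t) u(t)` by an operator-valued function
`b ∈ L^∞(ℝ, L(V, W))`, as a bounded operator `L²(0, τ; V) → L²(0, τ; W)`. -/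
def mulOp (τ : ℝ) {V W : Type*} [NormedAddCommGroup V] [NormedSpace ℂ V] [NormedAddCommGroup W]
    [NormedSpace ℂ W] (b : ℝ → V →L[ℂ] W) (hb : MemLp b ∞ volume) : L2 τ V →L[ℂ] L2 τ W :=
  (ContinuousLinearMap.id ℂ (V →L[ℂ] W)).holderL (periodMeasure τ) ∞ 2 2 ((hb.restrict _).toLp b)

theorem coeFn_mulOp (τ : ℝ) {V W : Type*} [NormedAddCommGroup V] [NormedSpace ℂ V]
    [NormedAddCommGroup W] [NormedSpace ℂ W] (b : ℝ → V →L[ℂ] W) (hb : MemLp b ∞ volume)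
    (u : L2 τ V) : mulOp τ b hb u =ᵐ[periodMeasure τ] fun t => b t (u t) := by
  have h := (ContinuousLinearMap.id ℂ (V →L[ℂ] W)).coeFn_holder (r := 2)
    ((hb.restrict (Ioc 0 τ)).toLp b) u
  filter_upwards [h, (hb.restrict (Ioc 0 τ)).coeFn_toLp] with t h1 h2
  rw [h2] at h1
  exact h1

/-- The data of the `τ`-periodic linear system
`x' = A(t) x + B(t) u + B_d(t) w`, `y = C(t) x + D(t) u`
in its mild formulation: `A(·)` enters through the evolution family that it generates. -/
structure PeriodicSystem (τ : ℝ) (X U₀ Ud₀ Y₀ : Type*)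
    [NormedAddCommGroup X] [NormedSpace ℂ X]
    [NormedAddCommGroup U₀] [InnerProductSpace ℂ U₀]
    [NormedAddCommGroup Ud₀] [InnerProductSpace ℂ Ud₀]
    [NormedAddCommGroup Y₀] [InnerProductSpace ℂ Y₀]
    extends PeriodicEvolutionFamily τ X where
  B : ℝ → U₀ →L[ℂ] X
  Bd : ℝ → Ud₀ →L[ℂ] X
  C : ℝ → X →L[ℂ] Y₀
  D : ℝ → U₀ →L[ℂ] Y₀
  memLp_B : MemLp B ∞ volume
  memLp_Bd : MemLp Bd ∞ volume
  memLp_C : MemLp C ∞ volume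
  memLp_D : MemLp D ∞ volume
  periodic_B : Function.Periodic B τ
  periodic_Bd : Function.Periodic Bd τ
  periodic_C : Function.Periodic C τ
  periodic_D : Function.Periodic D τ

/-- A `τ`-periodic locally square integrable function. -/
structure PeriodicSignal (τ : ℝ) (V : Type*) [NormedAddCommGroup V] where
  toFun : ℝ → V
  periodic : Function.Periodic toFun τ
  memLp : MemLp toFun 2 (periodMeasure τ)

namespace PeriodicSignal

variable {τ : ℝ} {V : Type*} [NormedAddCommGroup V]

instance : CoeFun (PeriodicSignal τ V) (fun _ => ℝ → V) := ⟨toFun⟩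

/-- The restriction of a periodic signal to one period, in `L²(0, τ; V)`. -/
def toL2 (f : PeriodicSignal τ V) : L2 τ V := f.memLp.toLp f

instance : Zero (PeriodicSignal τ V) := ⟨⟨fun _ => 0, fun _ => rfl, MemLp.zero⟩⟩

end PeriodicSignal

/-- The parameters `(G₁, G₂, K)` of the discrete-time controller
`z_{n+1} = G₁ z_n + G₂ (y(nτ + ·) - y_ref)`, `u(nτ + ·) = K z_n`. -/
structure Controller (τ : ℝ) (U₀ Y₀ Z : Type*)
    [NormedAddCommGroup U₀] [InnerProductSpace ℂ U₀]
    [NormedAddCommGroup Y₀] [InnerProductSpace ℂ Y₀]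
    [NormedAddCommGroup Z] [NormedSpace ℂ Z] where
  G₁ : Z →L[ℂ] Z
  G₂ : L2 τ Y₀ →L[ℂ] Z
  K : Z →L[ℂ] L2 τ U₀

section ClosedLoop

variable {τ : ℝ} {X U₀ Ud₀ Y₀ Z : Type*}
  [NormedAddCommGroup X] [NormedSpace ℂ X]
  [NormedAddCommGroup U₀] [InnerProductSpace ℂ U₀]
  [NormedAddCommGroup Ud₀] [InnerProductSpace ℂ Ud₀]
  [NormedAddCommGroup Y₀] [InnerProductSpace ℂ Y₀]
  [NormedAddCommGroup Z] [NormedSpace ℂ Z]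

/-- The operator `𝒫 u = C(·) ∫₀^τ G(·,s) B(s) u(s) ds + C(·) ∫₀^· U(·,s) B(s) u(s) ds + D(·) u`
from `L²(0, τ; U₀)` to `L²(0, τ; Y₀)`. -/
def PeriodicSystem.P [CompleteSpace X] (sys : PeriodicSystem τ X U₀ Ud₀ Y₀) :
    L2 τ U₀ →L[ℂ] L2 τ Y₀ :=
  mulOp τ sys.C sys.memLp_C ∘L sys.steadyStateOp ∘L mulOp τ sys.B sys.memLp_B +
    mulOp τ sys.D sys.memLp_D

/-- The operator `𝒫_d w = C(·) ∫₀^τ G(·,s) B_d(s) w(s) ds + C(·) ∫₀^· U(·,s) B_d(s) w(s) ds`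
from `L²(0, τ; U_{d0})` to `L²(0, τ; Y₀)`. -/
def PeriodicSystem.Pd [CompleteSpace X] (sys : PeriodicSystem τ X U₀ Ud₀ Y₀) :
    L2 τ Ud₀ →L[ℂ] L2 τ Y₀ :=
  mulOp τ sys.C sys.memLp_C ∘L sys.steadyStateOp ∘L mulOp τ sys.Bd sys.memLp_Bd

theorem PeriodicSystem.coeFn_P [CompleteSpace X] (sys : PeriodicSystem τ X U₀ Ud₀ Y₀)
    (u : L2 τ U₀) : sys.P u =ᵐ[periodMeasure τ] fun t =>
      sys.C t (∫ s in (0 : ℝ)..τ, sys.green t s (sys.B s (u s))) +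
      sys.C t (∫ s in (0 : ℝ)..t, sys.evol t s (sys.B s (u s))) + sys.D t (u t) := by
  have hB := coeFn_mulOp τ sys.B sys.memLp_B u
  filter_upwards [Lp.coeFn_add (mulOp τ sys.C sys.memLp_C (sys.steadyStateOp
    (mulOp τ sys.B sys.memLp_B u))) (mulOp τ sys.D sys.memLp_D u),
    coeFn_mulOp τ sys.C sys.memLp_C (sys.steadyStateOp (mulOp τ sys.B sys.memLp_B u)),
    sys.coeFn_steadyStateOp (mulOp τ sys.B sys.memLp_B u), coeFn_mulOp τ sys.D sys.memLp_D u,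
    ae_restrict_mem measurableSet_Ioc] with t h1 h2 h3 h4 ht
  rw [← map_add]
  refine h1.trans ?_
  rw [Pi.add_apply, h2, h3, h4, sys.steadyState_congr hB ht]
  rfl

theorem PeriodicSystem.coeFn_Pd [CompleteSpace X] (sys : PeriodicSystem τ X U₀ Ud₀ Y₀)
    (w : L2 τ Ud₀) : sys.Pd w =ᵐ[periodMeasure τ] fun t =>
      sys.C t (∫ s in (0 : ℝ)..τ, sys.green t s (sys.Bd s (w s))) +
      sys.C t (∫ s in (0 : ℝ)..t, sys.evol t s (sys.Bd s (w s))) := by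
  have hB := coeFn_mulOp τ sys.Bd sys.memLp_Bd w
  filter_upwards [coeFn_mulOp τ sys.C sys.memLp_C (sys.steadyStateOp
    (mulOp τ sys.Bd sys.memLp_Bd w)), sys.coeFn_steadyStateOp (mulOp τ sys.Bd sys.memLp_Bd w),
    ae_restrict_mem measurableSet_Ioc] with t h2 h3 ht
  rw [← map_add]
  refine h2.trans ?_
  rw [h3, sys.steadyState_congr hB ht]
  rfl

/-- A trajectory of the closed-loop system with reference `yref`, disturbance `wd`, and initial
states `x0`, `z0`: state `x`, output `y`, and control `u` on `[0, ∞)`, controller states `z n`, and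
regulation errors `e n = y(nτ + ·) - yref ∈ L²(0, τ; Y₀)`. -/
structure ClosedLoopTrajectory (sys : PeriodicSystem τ X U₀ Ud₀ Y₀) (ctrl : Controller τ U₀ Y₀ Z)
    (yref : PeriodicSignal τ Y₀) (wd : PeriodicSignal τ Ud₀) (x0 : X) (z0 : Z) where
  x : ℝ → X
  y : ℝ → Y₀
  u : ℝ → U₀
  z : ℕ → Z
  e : ℕ → L2 τ Y₀
  /-- The mild state. -/
  state_eq : ∀ t, 0 ≤ t → x t = sys.evol t 0 x0 +
    ∫ s in (0 : ℝ)..t, sys.evol t s (sys.B s (u s) + sys.Bd s (wd s))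
  output_eq : ∀ t, 0 ≤ t → y t = sys.C t (x t) + sys.D t (u t)
  control_eq : ∀ n : ℕ, (fun s => u (n * τ + s)) =ᵐ[periodMeasure τ] ctrl.K (z n)
  error_eq : ∀ n : ℕ, e n =ᵐ[periodMeasure τ] fun s => y (n * τ + s) - yref s
  z_zero : z 0 = z0
  z_succ : ∀ n, z (n + 1) = ctrl.G₁ (z n) + ctrl.G₂ (e n)

/-- For all signals and all initial states the closed-loop system has a trajectory. -/
def ClosedLoopWellPosed (sys : PeriodicSystem τ X U₀ Ud₀ Y₀) (ctrl : Controller τ U₀ Y₀ Z) : Prop :=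
  ∀ (yref : PeriodicSignal τ Y₀) (wd : PeriodicSignal τ Ud₀) (x0 : X) (z0 : Z),
    Nonempty (ClosedLoopTrajectory sys ctrl yref wd x0 z0)

/-- Exponential closed-loop stability (for `y_ref = 0` and `w_dist = 0`). -/
def ClosedLoopStable (sys : PeriodicSystem τ X U₀ Ud₀ Y₀) (ctrl : Controller τ U₀ Y₀ Z) : Prop :=
  ∃ M₀ > 0, ∃ M₁ > 0, ∃ α₀ > 0, ∃ α₁ > 0, ∀ (x0 : X) (z0 : Z)
    (T : ClosedLoopTrajectory sys ctrl 0 0 x0 z0),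
    (∀ t : ℝ, 0 ≤ t → ‖T.x t‖ ≤ M₀ * Real.exp (-α₀ * t) * (‖x0‖ + ‖z0‖)) ∧
    (∀ n : ℕ, ‖T.z n‖ ≤ M₁ * Real.exp (-α₁ * n) * (‖x0‖ + ‖z0‖))

/-- For all `τ`-periodic signals and all initial states the regulation error
`e n = y(nτ + ·) - y_ref` converges in `L²(0, τ; Y₀)` to `err y_ref w_dist`, at a uniform
exponential rate; in particular `‖e n‖ → ‖err y_ref w_dist‖`. -/
def ErrorConvergesTo (sys : PeriodicSystem τ X U₀ Ud₀ Y₀) (ctrl : Controller τ U₀ Y₀ Z)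
    (err : PeriodicSignal τ Y₀ → PeriodicSignal τ Ud₀ → L2 τ Y₀) : Prop :=
  ∃ M > 0, ∃ α > 0, ∀ (yref : PeriodicSignal τ Y₀) (wd : PeriodicSignal τ Ud₀) (x0 : X) (z0 : Z)
    (T : ClosedLoopTrajectory sys ctrl yref wd x0 z0) (n : ℕ),
    ‖T.e n - err yref wd‖ ≤
      M * Real.exp (-α * n) * (‖x0‖ + ‖z0‖ + ‖yref.toL2‖ + ‖wd.toL2‖)

/-- The asymptotic regulation error is `(I - Q) (𝒫 K z + 𝒫_d w_dist - y_ref)`, where `z` is the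
unique solution of `Q 𝒫 K z = Q y_ref - Q 𝒫_d w_dist`; here `Q` is a projection of `L²(0, τ; Y₀)`
onto the subspace `YN`. -/
def HasApproximateRegulationError [CompleteSpace X] (sys : PeriodicSystem τ X U₀ Ud₀ Y₀)
    (ctrl : Controller τ U₀ Y₀ Z) {YN : Submodule ℂ (L2 τ Y₀)} (Q : L2 τ Y₀ →L[ℂ] YN) : Prop :=
  ∃ zs : PeriodicSignal τ Y₀ → PeriodicSignal τ Ud₀ → Z,
    (∀ yref wd z, Q (sys.P (ctrl.K z)) = Q yref.toL2 - Q (sys.Pd wd.toL2) ↔ z = zs yref wd) ∧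
    ErrorConvergesTo sys ctrl fun yref wd =>
      (ContinuousLinearMap.id ℂ (L2 τ Y₀) - YN.subtypeL ∘L Q)
        (sys.P (ctrl.K (zs yref wd)) + sys.Pd wd.toL2 - yref.toL2)

end ClosedLoop

end

/-! Sampling at the instants `nτ` turns the closed loop into a recursion `ξ (n+1) = A ξ n + f` for
the pair of plant and controller state. The forcing `f` is constant because the exogenous signals
are periodic. Closed-loop stability is equivalent to power stability of `A`
(`closedLoopStable_of_powerStable`, `powerStable_of_closedLoopStable`). Under it `1 - A` is
invertible, the orbit tends geometrically to the unique fixed point, and the regulation error tends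
to its value there.

For small gain, `A` has the blocks `T`, `ε b`, `W`, `1 + ε d`, where `T = U(τ,0)` is power stable.
The controller moves slowly, so the plant stays near the quasi-steady state `ε L z` with `L = (1 -
T)⁻¹ b`. In the coordinate `w = x - ε L z` the controller follows `z ↦ z + ε S z` up to the coupling
`W w`, and `S = W L + d` is exactly `G₂ 𝒫 K₀`, whose spectrum lies in the open left half plane. A
weighted sum of two adapted seminorms then decreases along the recursion
(`exists_powerStable_blockOp`).

Since `G₁ = I`, a fixed point satisfies `z = z + G₂ e`, hence `G₂ e = 0` and `Q e = 0`. This uses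
only stability of the loop, so it survives perturbation. If `1 - U(τ,0)` is invertible, eliminating
the plant state gives `e = 𝒫 K z + 𝒫_d w - y_ref`, and `Q e = 0` becomes the equation for `z`. A
homogeneous solution of it would give a fixed point of `A`, so the solution is unique. -/

noncomputable section

/-! ### Evolution families: iterating periods and operators on one period -/

/-- On one period the `L¹` norm is dominated by the `L²` norm. -/
theorem exists_integral_norm_le_L2 (τ : ℝ) (V : Type*) [NormedAddCommGroup V] :
    ∃ c : ℝ, 0 ≤ c ∧ ∀ g : L2 τ V, ∫ s, ‖g s‖ ∂(periodMeasure τ) ≤ c * ‖g‖ := by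
  refine ⟨((periodMeasure τ) univ ^ (1 / (1 : ℝ≥0∞).toReal - 1 / (2 : ℝ≥0∞).toReal)).toReal,
    by positivity, fun g => ?_⟩
  have h := eLpNorm_le_eLpNorm_mul_rpow_measure_univ (μ := periodMeasure τ)
    (p := 1) (q := 2) (by norm_num) (Lp.aestronglyMeasurable g)
  rw [eLpNorm_one_eq_lintegral_enorm] at h
  rw [integral_norm_eq_lintegral_enorm (Lp.aestronglyMeasurable g), Lp.norm_def, mul_comm,
    ← ENNReal.toReal_mul]
  refine ENNReal.toReal_mono (ENNReal.mul_ne_top (Lp.memLp g).2.ne ?_) h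
  exact ENNReal.rpow_ne_top_of_nonneg (by norm_num) (measure_ne_top _ _)

theorem integrable_coeFn_L2 {τ : ℝ} {V : Type*} [NormedAddCommGroup V] (g : L2 τ V) :
    Integrable g (periodMeasure τ) :=
  (Lp.memLp g).integrable (by norm_num)

namespace PeriodicEvolutionFamily

variable {τ : ℝ} {X : Type*} [NormedAddCommGroup X] [NormedSpace ℂ X]

theorem evol_periodic_nat (E : PeriodicEvolutionFamily τ X) (n : ℕ) {t s : ℝ} (h : s ≤ t) :
    E.evol (n * τ + t) (n * τ + s) = E.evol t s := by
  induction n with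
  | zero => simp
  | succ n ih =>
    have h' := E.evol_periodic (n * τ + t) (n * τ + s) (by linarith)
    rw [← ih, ← h']
    push_cast
    ring_nf

theorem evol_nat_mul (E : PeriodicEvolutionFamily τ X) (n : ℕ) :
    E.evol (n * τ) 0 = E.evol τ 0 ^ n := by
  induction n with
  | zero => simp [E.evol_self, ContinuousLinearMap.one_def]
  | succ n ih =>
    have hτ := E.period_pos
    have h := E.evol_periodic_nat n (t := τ) (s := 0) hτ.le
    have h' := E.evol_comp (n * τ + τ) (n * τ) 0 (by positivity) (by linarith)
    rw [add_zero] at h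
    rw [h, ih] at h'
    rw [pow_succ', ContinuousLinearMap.mul_def, h']
    push_cast
    ring_nf

/-- A `τ`-periodic evolution family is also `(n+1)τ`-periodic. -/
def multiple (E : PeriodicEvolutionFamily τ X) (n : ℕ) :
    PeriodicEvolutionFamily ((n + 1 : ℕ) * τ) X where
  period_pos := mul_pos (by positivity) E.period_pos
  evol := E.evol
  evol_self := E.evol_self
  evol_comp := E.evol_comp
  evol_cont := E.evol_cont
  evol_periodic t s h := by
    rw [add_comm t, add_comm s, E.evol_periodic_nat _ h]

/-- A function on `ℝ` all of whose restrictions to periods are integrable is integrable on every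
`[0, Nτ]`. -/
theorem integrable_of_forall_period (E : PeriodicEvolutionFamily τ X) {f : ℝ → X}
    (hf : ∀ n : ℕ, Integrable (fun s => f (n * τ + s)) (periodMeasure τ)) (n : ℕ) :
    Integrable f (periodMeasure (n * τ)) := by
  have hτ := E.period_pos
  have h : IntervalIntegrable f volume ((0 : ℕ) * τ) (n * τ) := by
    refine IntervalIntegrable.trans_iterate (a := fun k : ℕ => (k : ℝ) * τ) fun k _ => ?_
    have hk : IntervalIntegrable (fun s => f (k * τ + s)) volume 0 τ :=
      (intervalIntegrable_iff_integrableOn_Ioc_of_le hτ.le).2 (hf k)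
    have hk' := hk.comp_add_left (-(k * τ))
    simp only [add_neg_cancel_left] at hk'
    convert hk' using 1 <;> push_cast <;> ring
  have h' := (intervalIntegrable_iff_integrableOn_Ioc_of_le (by simp; positivity)).1 h
  simpa [IntegrableOn] using h'

variable [CompleteSpace X]

theorem integrable_evol_ite (E : PeriodicEvolutionFamily τ X) {g : ℝ → X}
    (hg : Integrable g (periodMeasure τ)) {t : ℝ} (ht : t ∈ Ioc 0 τ) :
    Integrable (fun s => if s ≤ t then E.evol t s (g s) else 0) (periodMeasure τ) := by
  obtain ⟨M, hM⟩ := E.exists_bound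
  refine (hg.norm.const_mul M).mono' (E.aestronglyMeasurable_evol hg.1 ht) ?_
  filter_upwards [ae_restrict_mem measurableSet_Ioc] with s hs
  split_ifs with h
  · exact ContinuousLinearMap.le_of_opNorm_le _ (hM _ _ hs.1.le h ht.2) _
  · simp; positivity

theorem intervalIntegrable_evol_of_mem (E : PeriodicEvolutionFamily τ X) {g : ℝ → X}
    (hg : Integrable g (periodMeasure τ)) {t : ℝ} (ht : t ∈ Icc 0 τ) :
    IntervalIntegrable (fun s => E.evol t s (g s)) volume 0 t := by
  rcases ht.1.eq_or_lt with rfl | h0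
  · simp
  rw [intervalIntegrable_iff_integrableOn_Ioc_of_le ht.1]
  have h : IntegrableOn (fun s => if s ≤ t then E.evol t s (g s) else 0) (Ioc 0 t) :=
    IntegrableOn.mono_set (E.integrable_evol_ite hg ⟨h0, ht.2⟩) (Ioc_subset_Ioc_right ht.2)
  refine h.congr_fun (fun s hs => ?_) measurableSet_Ioc
  simp [hs.2]

/-- The family is also periodic with any multiple of `τ` exceeding `t`, which reduces the claim to
the case of a single, longer period. -/
theorem intervalIntegrable_evol (E : PeriodicEvolutionFamily τ X) {f : ℝ → X}
    (hf : ∀ n : ℕ, Integrable (fun s => f (n * τ + s)) (periodMeasure τ)) {t : ℝ} (ht : 0 ≤ t) :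
    IntervalIntegrable (fun s => E.evol t s (f s)) volume 0 t := by
  have hτ := E.period_pos
  have hn : t ≤ (⌈t / τ⌉₊ + 1 : ℕ) * τ := by
    rw [← div_le_iff₀ hτ]
    push_cast
    linarith [Nat.le_ceil (t / τ)]
  exact (E.multiple ⌈t / τ⌉₊).intervalIntegrable_evol_of_mem
    (E.integrable_of_forall_period hf _) ⟨ht, hn⟩

/-- The mild solution over the period `[nτ, (n+1)τ]`, started from its value at `nτ`. -/
theorem mild_add_period (E : PeriodicEvolutionFamily τ X) {f x : ℝ → X} {x₀ : X}
    (hf : ∀ n : ℕ, Integrable (fun s => f (n * τ + s)) (periodMeasure τ))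
    (hx : ∀ t, 0 ≤ t → x t = E.evol t 0 x₀ + ∫ s in (0 : ℝ)..t, E.evol t s (f s))
    (n : ℕ) {t : ℝ} (ht : 0 ≤ t) :
    x (n * τ + t) = E.evol t 0 (x (n * τ)) +
      ∫ s in (0 : ℝ)..t, E.evol t s (f (n * τ + s)) := by
  have hτ := E.period_pos
  have hn : 0 ≤ n * τ := by positivity
  have hint := E.intervalIntegrable_evol hf (t := n * τ + t) (by positivity)
  have hper : E.evol (n * τ + t) (n * τ) = E.evol t 0 := by
    simpa using E.evol_periodic_nat n ht
  have h1 : IntervalIntegrable (fun s => E.evol (n * τ + t) s (f s)) volume 0 (n * τ) :=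
    hint.mono_set (by rw [uIcc_of_le hn, uIcc_of_le (by linarith)]
                      exact Icc_subset_Icc_right (by linarith))
  have h2 : IntervalIntegrable (fun s => E.evol (n * τ + t) s (f s)) volume (n * τ) (n * τ + t) :=
    hint.mono_set (by rw [uIcc_of_le (by linarith), uIcc_of_le (by linarith)]
                      exact Icc_subset_Icc_left (by linarith))
  rw [hx _ (by positivity), hx _ hn, ← intervalIntegral.integral_add_adjacent_intervals h1 h2,
    map_add, ← ContinuousLinearMap.intervalIntegral_comp_comm _ (E.intervalIntegrable_evol hf hn),
    ← E.evol_comp (n * τ + t) (n * τ) 0 hn (by linarith), hper, add_assoc]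
  refine congrArg₂ _ rfl (congrArg₂ _ ?_ ?_)
  · refine intervalIntegral.integral_congr fun s hs => ?_
    rw [uIcc_of_le hn] at hs
    rw [← E.evol_comp (n * τ + t) (n * τ) s hs.2 (by linarith), hper]
    rfl
  · have h3 := intervalIntegral.integral_comp_add_left (a := 0) (b := t)
      (fun s => E.evol (n * τ + t) s (f s)) (n * τ)
    rw [add_zero] at h3
    rw [← h3]
    refine intervalIntegral.integral_congr fun s hs => ?_
    rw [uIcc_of_le ht] at hs
    rw [E.evol_periodic_nat n hs.2]

/-- The response `∫₀ᵗ U(t,s) g(s) ds` is bounded by the `L²` norm of `g`, uniformly on a period. -/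
theorem exists_forced_bound (E : PeriodicEvolutionFamily τ X) :
    ∃ c : ℝ, 0 ≤ c ∧ ∀ g : L2 τ X, ∀ t ∈ Icc 0 τ,
      ‖∫ s in (0 : ℝ)..t, E.evol t s (g s)‖ ≤ c * ‖g‖ := by
  obtain ⟨M, hM⟩ := E.exists_bound
  obtain ⟨c, hc0, hc⟩ := exists_integral_norm_le_L2 τ X
  refine ⟨M * c, by positivity, fun g t ht => ?_⟩
  have hg := integrable_coeFn_L2 g
  have hsub : Ioc 0 t ⊆ Ioc 0 τ := Ioc_subset_Ioc_right ht.2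
  have hgt : IntegrableOn (fun s => ‖g s‖) (Ioc 0 t) := IntegrableOn.mono_set hg.norm hsub
  calc ‖∫ s in (0 : ℝ)..t, E.evol t s (g s)‖
      ≤ ∫ s in Ioc 0 t, M * ‖g s‖ := by
        rw [intervalIntegral.integral_of_le ht.1]
        refine norm_integral_le_of_norm_le (hgt.const_mul _) ?_
        filter_upwards [ae_restrict_mem measurableSet_Ioc] with s hs
        exact ContinuousLinearMap.le_of_opNorm_le _ (hM _ _ hs.1.le hs.2 ht.2) _
    _ ≤ ∫ s in Ioc 0 τ, M * ‖g s‖ := by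
        refine setIntegral_mono_set (hg.norm.const_mul _) (ae_of_all _ fun s => by positivity) ?_
        exact hsub.eventuallyLE
    _ ≤ M * c * ‖g‖ := by
        rw [integral_const_mul, mul_assoc]
        exact mul_le_mul_of_nonneg_left (hc g) M.2

/-- The state `∫₀^τ U(τ,s) g(s) ds` reached at the end of a period from the zero state. -/
def terminalOp (E : PeriodicEvolutionFamily τ X) : L2 τ X →L[ℂ] X :=
  LinearMap.mkContinuousOfExistsBound
    { toFun := fun g => ∫ s in (0 : ℝ)..τ, E.evol τ s (g s)
      map_add' := fun f g => by
        have hτ : τ ∈ Icc 0 τ := ⟨E.period_pos.le, le_rfl⟩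
        rw [← intervalIntegral.integral_add
          (E.intervalIntegrable_evol_of_mem (integrable_coeFn_L2 f) hτ)
          (E.intervalIntegrable_evol_of_mem (integrable_coeFn_L2 g) hτ)]
        rw [intervalIntegral.integral_of_le hτ.1, intervalIntegral.integral_of_le hτ.1]
        refine integral_congr_ae ?_
        filter_upwards [Lp.coeFn_add f g] with s hs
        rw [hs, Pi.add_apply, map_add]
      map_smul' := fun a g => by
        rw [RingHom.id_apply, ← intervalIntegral.integral_smul,
          intervalIntegral.integral_of_le E.period_pos.le,
          intervalIntegral.integral_of_le E.period_pos.le]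
        refine integral_congr_ae ?_
        filter_upwards [Lp.coeFn_smul a g] with s hs
        rw [hs, Pi.smul_apply, map_smul] }
    (by
      obtain ⟨c, -, hc⟩ := E.exists_forced_bound
      exact ⟨c, fun g => hc g τ ⟨E.period_pos.le, le_rfl⟩⟩)

theorem terminalOp_apply (E : PeriodicEvolutionFamily τ X) (g : L2 τ X) :
    E.terminalOp g = ∫ s in (0 : ℝ)..τ, E.evol τ s (g s) :=
  rfl

theorem memLp_free (E : PeriodicEvolutionFamily τ X) (x : X) :
    MemLp (fun t => E.evol t 0 x) 2 (periodMeasure τ) := by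
  obtain ⟨M, hM⟩ := E.exists_bound
  have hc := E.continuous_clamped
  have h1 : Continuous fun t : ℝ => E.clamped ((t, 0), x) := by fun_prop
  refine MemLp.of_bound (h1.aestronglyMeasurable.congr ?_) (M * ‖x‖) ?_
  · filter_upwards [ae_restrict_mem measurableSet_Ioc] with t ht
    exact E.clamped_eq le_rfl ht.1.le ht.2 x
  · filter_upwards [ae_restrict_mem measurableSet_Ioc] with t ht
    exact ContinuousLinearMap.le_of_opNorm_le _ (hM _ _ le_rfl ht.1.le ht.2) _

/-- The free motion `x ↦ U(·,0) x` on one period. -/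
def freeOp (E : PeriodicEvolutionFamily τ X) : X →L[ℂ] L2 τ X :=
  LinearMap.mkContinuousOfExistsBound
    { toFun := fun x => (E.memLp_free x).toLp _
      map_add' := fun x y => by
        rw [← MemLp.toLp_add]
        exact MemLp.toLp_congr _ _ (ae_of_all _ fun t => map_add _ x y)
      map_smul' := fun a x => by
        rw [RingHom.id_apply, ← MemLp.toLp_const_smul]
        exact MemLp.toLp_congr _ _ (ae_of_all _ fun t => map_smul _ a x) }
    (by
      obtain ⟨M, hM⟩ := E.exists_bound
      refine ⟨measureUnivNNReal (periodMeasure τ) ^ ((2 : ℝ≥0∞).toReal)⁻¹ * M, fun x => ?_⟩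
      rw [mul_assoc]
      refine Lp.norm_le_of_ae_bound (p := 2) (f := (E.memLp_free x).toLp _) (C := M * ‖x‖)
        (by positivity) ?_
      filter_upwards [(E.memLp_free x).coeFn_toLp, ae_restrict_mem measurableSet_Ioc] with t h1 ht
      rw [h1]
      exact ContinuousLinearMap.le_of_opNorm_le _ (hM _ _ le_rfl ht.1.le ht.2) _)

theorem coeFn_freeOp (E : PeriodicEvolutionFamily τ X) (x : X) :
    E.freeOp x =ᵐ[periodMeasure τ] fun t => E.evol t 0 x :=
  (E.memLp_free x).coeFn_toLp

/-- The forced motion `g ↦ ∫₀ᵗ U(t,s) g(s) ds` on one period. -/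
def forcedOp (E : PeriodicEvolutionFamily τ X) : L2 τ X →L[ℂ] L2 τ X :=
  E.steadyStateOp - E.freeOp ∘L E.monodromyResolvent ∘L E.terminalOp

theorem steadyStateOp_eq (E : PeriodicEvolutionFamily τ X) :
    E.steadyStateOp = E.freeOp ∘L E.monodromyResolvent ∘L E.terminalOp + E.forcedOp := by
  simp [forcedOp]

/-- The first integral in `steadyState` factors as the free motion started at `monodromyResolvent`
of the terminal state, so subtracting it leaves the causal integral. The cancellation is valid
whatever bounded operator `monodromyResolvent` is, so it also covers families with `1` in the
spectrum of `U(τ,0)`. -/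
theorem coeFn_forcedOp (E : PeriodicEvolutionFamily τ X) (g : L2 τ X) :
    E.forcedOp g =ᵐ[periodMeasure τ] fun t => ∫ s in (0 : ℝ)..t, E.evol t s (g s) := by
  have hτ : τ ∈ Icc 0 τ := ⟨E.period_pos.le, le_rfl⟩
  filter_upwards [Lp.coeFn_sub (E.steadyStateOp g)
      (E.freeOp (E.monodromyResolvent (E.terminalOp g))), E.coeFn_steadyStateOp g,
    E.coeFn_freeOp (E.monodromyResolvent (E.terminalOp g))] with t h1 h2 h3
  refine h1.trans ?_
  rw [Pi.sub_apply, h2, h3, steadyState, sub_eq_iff_eq_add, add_comm, terminalOp_apply]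
  congr 1
  have h := (E.evol t 0 ∘L E.monodromyResolvent).intervalIntegral_comp_comm
    (E.intervalIntegrable_evol_of_mem (integrable_coeFn_L2 g) hτ)
  exact h

end PeriodicEvolutionFamily

end

/-! ### Power stability and adapted seminorms -/

section PowerStable

variable {V : Type*} [NormedAddCommGroup V] [NormedSpace ℂ V]

/-- Power stability `‖Aⁿ‖ ≤ M ρⁿ` with `ρ < 1`. -/
def PowerStable (A : V →L[ℂ] V) : Prop :=
  ∃ M > 0, ∃ ρ > 0, ρ < 1 ∧ ∀ (n : ℕ) (v : V), ‖(A ^ n) v‖ ≤ M * ρ ^ n * ‖v‖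

/-- Any `q` strictly between `ρ` and `1` works: `M (ρ/q)^N` tends to zero, so a large power absorbs
the constant `M`. -/
theorem PowerStable.exists_pow_norm_le {A : V →L[ℂ] V} (hA : PowerStable A) :
    ∃ q > 0, q < 1 ∧ ∃ N > 0, ‖A ^ N‖ ≤ q ^ N := by
  obtain ⟨M, hM, ρ, hρ, hρ1, h⟩ := hA
  have hq : ρ < (ρ + 1) / 2 := by linarith
  have hq0 : 0 < (ρ + 1) / 2 := by linarith
  have ht := (tendsto_pow_atTop_nhds_zero_of_lt_one (by positivity)
    ((div_lt_one hq0).2 hq)).const_mul M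
  rw [mul_zero] at ht
  obtain ⟨N, hN, hN0⟩ := ((ht.eventually_lt_const one_pos).and (eventually_gt_atTop 0)).exists
  refine ⟨(ρ + 1) / 2, hq0, by linarith, N, hN0, ?_⟩
  refine ContinuousLinearMap.opNorm_le_bound _ (by positivity) fun v => (h N v).trans ?_
  gcongr
  rw [div_pow, ← mul_div_assoc, div_lt_one (by positivity)] at hN
  exact hN.le

/-- An operator whose `N`-th power has norm at most `q ^ N` contracts an equivalent seminorm. -/
theorem exists_seminorm_contracting (A : V →L[ℂ] V) {q : ℝ} (hq : 0 < q) {N : ℕ} (hN : 0 < N)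
    (h : ‖A ^ N‖ ≤ q ^ N) :
    ∃ p : Seminorm ℂ V, ∃ c > 0, (∀ v, ‖v‖ ≤ p v) ∧ (∀ v, p v ≤ c * ‖v‖) ∧
      ∀ v, p (A v) ≤ q * p v := by
  let p : Seminorm ℂ V := Seminorm.of (fun v => ∑ k ∈ Finset.range N, (q ^ k)⁻¹ * ‖(A ^ k) v‖)
    (fun v w => by
      rw [← Finset.sum_add_distrib]
      refine Finset.sum_le_sum fun k _ => ?_
      rw [← mul_add, map_add]
      gcongr
      exact norm_add_le _ _)
    (fun a v => by
      rw [Finset.mul_sum]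
      refine Finset.sum_congr rfl fun k _ => ?_
      rw [map_smul, norm_smul]
      ring)
  have hp : ∀ v, p v = ∑ k ∈ Finset.range N, (q ^ k)⁻¹ * ‖(A ^ k) v‖ := fun v => rfl
  refine ⟨p, 1 + ∑ k ∈ Finset.range N, (q ^ k)⁻¹ * ‖A ^ k‖, by positivity,
    fun v => ?_, fun v => ?_, fun v => ?_⟩
  · rw [hp]
    have := Finset.single_le_sum (f := fun k => (q ^ k)⁻¹ * ‖(A ^ k) v‖)
      (fun k _ => by positivity) (Finset.mem_range.2 hN)
    simpa using this
  · rw [hp, add_mul, Finset.sum_mul, one_mul]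
    refine le_add_of_nonneg_of_le (norm_nonneg _) (Finset.sum_le_sum fun k _ => ?_)
    rw [mul_assoc]
    gcongr
    exact (A ^ k).le_opNorm v
  · obtain ⟨N, rfl⟩ := Nat.exists_eq_succ_of_ne_zero hN.ne'
    rw [hp, hp, Finset.sum_range_succ, Finset.sum_range_succ', mul_add, Finset.mul_sum]
    -- Applying `A` shifts the weighted sum by one index at the cost of a factor `q`. The new top
    -- term contains the `N`-th power in the hypothesis and is at most `q ‖v‖`, that is, `q` times
    -- the term `k = 0`.
    refine add_le_add (Finset.sum_le_sum fun k _ => le_of_eq ?_) ?_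
    · rw [pow_succ A k, mul_apply_eq_comp, pow_succ q k]
      field_simp
    · have h1 : ‖(A ^ N) (A v)‖ ≤ q ^ (N + 1) * ‖v‖ := by
        have := ContinuousLinearMap.le_of_opNorm_le _ h v
        rwa [pow_succ A N, mul_apply_eq_comp] at this
      simp only [pow_zero, inv_one, one_mul, one_apply_eq_self]
      rw [inv_mul_le_iff₀ (by positivity)]
      refine h1.trans (le_of_eq ?_)
      ring

theorem powerStable_of_seminorm (A : V →L[ℂ] V) (p : V → ℝ) {c₀ c₁ q : ℝ} (hc₀ : 0 < c₀)
    (hc₁ : 0 < c₁) (hq : 0 < q) (hq1 : q < 1) (h₀ : ∀ v, c₀ * ‖v‖ ≤ p v)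
    (h₁ : ∀ v, p v ≤ c₁ * ‖v‖) (h : ∀ v, p (A v) ≤ q * p v) : PowerStable A := by
  refine ⟨c₁ / c₀, by positivity, q, hq, hq1, fun n v => ?_⟩
  have hn : ∀ n : ℕ, p ((A ^ n) v) ≤ q ^ n * p v := by
    intro n
    induction n with
    | zero => simp
    | succ n ih =>
      rw [pow_succ', mul_apply_eq_comp, pow_succ', mul_assoc]
      exact (h _).trans (mul_le_mul_of_nonneg_left ih hq.le)
  have h2 : c₀ * ‖(A ^ n) v‖ ≤ q ^ n * (c₁ * ‖v‖) :=
    (h₀ _).trans ((hn n).trans (mul_le_mul_of_nonneg_left (h₁ v) (by positivity)))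
  rw [← le_div_iff₀' hc₀] at h2
  refine h2.trans (le_of_eq ?_)
  ring

/-- Some power has norm below one, so `1 - A ^ N` is invertible by a Neumann series; it is a
commuting product of `1 - A` with a geometric sum. -/
theorem PowerStable.isUnit_one_sub [CompleteSpace V] {A : V →L[ℂ] V} (hA : PowerStable A) :
    IsUnit (1 - A) := by
  obtain ⟨q, hq, hq1, N, hN, h⟩ := hA.exists_pow_norm_le
  have hu : IsUnit (1 - A ^ N) :=
    isUnit_one_sub_of_norm_lt_one (h.trans_lt (pow_lt_one₀ hq.le hq1 hN.ne'))
  rw [← mul_neg_geom_sum A N] at hu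
  have hc : Commute (1 - A) (∑ i ∈ Finset.range N, A ^ i) := by
    rw [Commute, SemiconjBy, mul_neg_geom_sum, geom_sum_mul_neg]
  exact (hc.isUnit_mul_iff.1 hu).1

/-- The distance of an orbit of `v ↦ A v + f` from a fixed point evolves under the powers of `A`. -/
theorem affine_iterate_sub_fixedPoint {A : V →L[ℂ] V} {f v' : V} {v : ℕ → V}
    (hv : ∀ n, v (n + 1) = A (v n) + f) (hv' : v' = A v' + f) (n : ℕ) :
    v n - v' = (A ^ n) (v 0 - v') := by
  induction n with
  | zero => simp
  | succ n ih =>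
    rw [pow_succ', mul_apply_eq_comp, ← ih, map_sub, hv]
    nth_rewrite 1 [hv']
    abel

/-- If the spectrum of `S` lies in the open left half plane, then some `I + ε₀ S` has a power of
norm less than one. -/
theorem exists_pow_norm_le_of_spectrum_re_neg [CompleteSpace V] (S : V →L[ℂ] V)
    (hS : ∀ μ ∈ spectrum ℂ S, μ.re < 0) :
    ∃ ε : ℝ, 0 < ε ∧ ∃ q > 0, q < 1 ∧ ∃ N > 0, ‖((1 : V →L[ℂ] V) + (ε : ℂ) • S) ^ N‖ ≤ q ^ N := by
  rcases subsingleton_or_nontrivial V with hV | hV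
  -- On the zero space the spectrum is empty, so the maximum used below would not exist.
  · refine ⟨1, one_pos, 1 / 2, by norm_num, by norm_num, 1, one_pos, ?_⟩
    rw [Subsingleton.elim (((1 : V →L[ℂ] V) + ((1 : ℝ) : ℂ) • S) ^ 1) 0]
    simp
  have hcomp := spectrum.isCompact (𝕜 := ℂ) S
  have hne := spectrum.nonempty S
  obtain ⟨μ₀, hμ₀, hmax⟩ := hcomp.exists_isMaxOn hne Complex.continuous_re.continuousOn
  obtain ⟨R, hR⟩ := hcomp.exists_bound_of_continuousOn (f := fun μ : ℂ => μ) continuousOn_id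
  set δ : ℝ := -μ₀.re with hδdef
  have hδ : 0 < δ := neg_pos.2 (hS _ hμ₀)
  have hre : ∀ μ ∈ spectrum ℂ S, μ.re ≤ -δ := fun μ hμ => by
    have : μ.re ≤ μ₀.re := hmax hμ
    linarith
  have hR0 : 0 ≤ R := (norm_nonneg _).trans (hR μ₀ hμ₀)
  -- With `Re μ ≤ -δ` and `|μ| ≤ R`, `|1 + ε μ|² ≤ 1 - 2εδ + ε²R²`. This `ε` makes the last term at
  -- most `εδ`; the `+ 1` covers `R = 0`.
  set ε : ℝ := δ / (R ^ 2 + 1) with hε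
  have hεp : 0 < ε := by positivity
  have hεR : ε * R ^ 2 ≤ δ := by
    rw [hε, div_mul_eq_mul_div, div_le_iff₀ (by positivity)]
    nlinarith
  have hbd : ∀ z ∈ spectrum ℂ ((1 : V →L[ℂ] V) + (ε : ℂ) • S), ‖z‖₊ < 1 := by
    intro z hz
    rw [← map_one (algebraMap ℂ (V →L[ℂ] V)), ← spectrum.singleton_add_eq,
      spectrum.smul_eq_smul _ _ hne] at hz
    obtain ⟨_, rfl, _, ⟨μ, hμ, rfl⟩, rfl⟩ := hz
    have h1 := hre μ hμ
    have h2 := hR μ hμ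
    have h3 : ‖μ‖ ^ 2 = μ.re ^ 2 + μ.im ^ 2 := by
      rw [Complex.sq_norm, Complex.normSq_apply]; ring
    have h4 : ‖μ‖ ^ 2 ≤ R ^ 2 := by gcongr
    have h5 : ‖(1 : ℂ) + ε * μ‖ ^ 2 < 1 := by
      rw [Complex.sq_norm, Complex.normSq_apply]
      simp only [Complex.add_re, Complex.one_re, Complex.mul_re, Complex.ofReal_re,
        Complex.ofReal_im, zero_mul, sub_zero, Complex.add_im, Complex.one_im, Complex.mul_im,
        add_zero, zero_add]
      have h6 : ε * (ε * ‖μ‖ ^ 2) ≤ ε * δ :=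
        mul_le_mul_of_nonneg_left
          ((mul_le_mul_of_nonneg_left h4 hεp.le).trans hεR) hεp.le
      have h7 : ε * μ.re ≤ ε * -δ := mul_le_mul_of_nonneg_left h1 hεp.le
      have h8 : 0 < ε * δ := by positivity
      rw [h3] at h6
      nlinarith
    have h9 : ‖(1 : ℂ) + ε * μ‖ < 1 := by
      rwa [sq_lt_one_iff₀ (norm_nonneg _)] at h5
    exact_mod_cast h9
  -- By compactness of the spectrum its radius is below one, and Gelfand's formula turns this into a
  -- bound on one power.
  have hr := spectrum.spectralRadius_lt_of_forall_lt _ hbd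
  obtain ⟨q, hq, hq1⟩ := ENNReal.lt_iff_exists_nnreal_btwn.1 hr
  have ht := spectrum.pow_nnnorm_pow_one_div_tendsto_nhds_spectralRadius
    ((1 : V →L[ℂ] V) + (ε : ℂ) • S)
  obtain ⟨N, hN, hN0⟩ := ((ht.eventually_lt_const hq).and (eventually_gt_atTop 0)).exists
  have hqpos : 0 < q := by
    rcases eq_or_ne q 0 with rfl | h
    · simp at hq
    · exact pos_iff_ne_zero.2 h
  refine ⟨ε, hεp, q, by exact_mod_cast hqpos, by exact_mod_cast hq1, N, hN0, ?_⟩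
  have hN' := ENNReal.rpow_le_rpow hN.le (z := N) (by positivity)
  rw [← ENNReal.rpow_mul, one_div, inv_mul_cancel₀ (by positivity), ENNReal.rpow_one,
    ENNReal.rpow_natCast] at hN'
  exact_mod_cast hN'

/-- A seminorm for which `I + ε S` contracts at a rate linear in `ε`. -/
theorem exists_seminorm_one_add_smul_le [CompleteSpace V] (S : V →L[ℂ] V)
    (hS : ∀ μ ∈ spectrum ℂ S, μ.re < 0) :
    ∃ p : Seminorm ℂ V, ∃ c > 0, ∃ ε₀ : ℝ, 0 < ε₀ ∧ ∃ κ > 0, (∀ v, ‖v‖ ≤ p v) ∧ (∀ v, p v ≤ c * ‖v‖) ∧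
      ∀ ε : ℝ, 0 < ε → ε ≤ ε₀ → ∀ v, p (v + (ε : ℂ) • S v) ≤ (1 - κ * ε) * p v := by
  obtain ⟨ε₀, hε₀, q, hq, hq1, N, hN, h⟩ := exists_pow_norm_le_of_spectrum_re_neg S hS
  obtain ⟨p, c, hc, h1, h2, h3⟩ := exists_seminorm_contracting _ hq hN h
  refine ⟨p, c, hc, ε₀, hε₀, (1 - q) / ε₀, div_pos (by linarith) hε₀, h1, h2,
    fun ε hε hle v => ?_⟩
  have hr0 : 0 ≤ ε / ε₀ := by positivity
  have hr1 : ε / ε₀ ≤ 1 := (div_le_one hε₀).2 hle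
  -- For `ε ≤ ε₀`, `I + ε S` is a convex combination of `I` and `I + ε₀ S`. Its contraction factor
  -- is therefore `1 - (1 - q) ε / ε₀`, which explains the rate `κ`.
  have hdec : v + (ε : ℂ) • S v = ((1 - ε / ε₀ : ℝ) : ℂ) • v +
      ((ε / ε₀ : ℝ) : ℂ) • ((1 : V →L[ℂ] V) + (ε₀ : ℂ) • S) v := by
    have hne : (ε₀ : ℂ) ≠ 0 := by exact_mod_cast hε₀.ne'
    simp only [add_apply, one_apply_eq_self,
      smul_apply, smul_add, smul_smul]
    push_cast
    rw [div_mul_cancel₀ _ hne, ← add_assoc, ← add_smul]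
    simp
  rw [hdec]
  refine (map_add_le_add p _ _).trans ?_
  rw [map_smul_eq_mul, map_smul_eq_mul, Complex.norm_real, Complex.norm_real,
    Real.norm_of_nonneg (by linarith), Real.norm_of_nonneg hr0]
  have := mul_le_mul_of_nonneg_left (h3 v) hr0
  refine (add_le_add_right this _).trans (le_of_eq ?_)
  field_simp
  ring

end PowerStable

/-! ### Low-gain integral control in discrete time -/

section BlockOperator

variable {X Z : Type*} [NormedAddCommGroup X] [NormedSpace ℂ X]
  [NormedAddCommGroup Z] [NormedSpace ℂ Z]

/-- The block operator `(x, z) ↦ (T x + b z, W x + d z)`. -/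
noncomputable def blockOp (T : X →L[ℂ] X) (b : Z →L[ℂ] X) (W : X →L[ℂ] Z) (d : Z →L[ℂ] Z) :
    X × Z →L[ℂ] X × Z :=
  (T ∘L ContinuousLinearMap.fst ℂ X Z + b ∘L ContinuousLinearMap.snd ℂ X Z).prod
    (W ∘L ContinuousLinearMap.fst ℂ X Z + d ∘L ContinuousLinearMap.snd ℂ X Z)

@[simp]
theorem blockOp_apply (T : X →L[ℂ] X) (b : Z →L[ℂ] X) (W : X →L[ℂ] Z) (d : Z →L[ℂ] Z)
    (v : X × Z) : blockOp T b W d v = (T v.1 + b v.2, W v.1 + d v.2) :=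
  rfl

/-- Low-gain integral control of a power stable system: if the spectrum of the transfer matrix
`W (I - T)⁻¹ b + d` at `1` lies in the open left half plane, then the closed loop is power stable
for all sufficiently small gains. The operator `L` plays the role of `(I - T)⁻¹ b`. -/
theorem exists_powerStable_blockOp [CompleteSpace Z] {T : X →L[ℂ] X} (hT : PowerStable T)
    (b L : Z →L[ℂ] X) (W : X →L[ℂ] Z) (d : Z →L[ℂ] Z) (hL : ∀ z, L z = T (L z) + b z)
    (hS : ∀ μ ∈ spectrum ℂ (W ∘L L + d), μ.re < 0) :
    ∃ εstar : ℝ, 0 < εstar ∧ ∀ ε : ℝ, 0 < ε → ε ≤ εstar →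
      PowerStable (blockOp T ((ε : ℂ) • b) W (1 + (ε : ℂ) • d)) := by
  obtain ⟨q, hq, hq1, N, hN, hTN⟩ := hT.exists_pow_norm_le
  obtain ⟨p, c, hc, hp1, hp2, hp3⟩ := exists_seminorm_contracting T hq hN hTN
  set S := W ∘L L + d with hSdef
  obtain ⟨σ, c', hc', ε₀, hε₀, κ, hκ, hσ1, hσ2, hσ3⟩ := exists_seminorm_one_add_smul_le S hS
  set k₁ := c * ‖L ∘L W‖ with hk₁
  set k₂ := c * ‖L ∘L S‖ with hk₂
  set k₃ := c' * ‖W‖ with hk₃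
  have hk₁0 : 0 ≤ k₁ := by positivity
  have hk₂0 : 0 ≤ k₂ := by positivity
  have hk₃0 : 0 ≤ k₃ := by positivity
  have hq1' : 0 < 1 - q := by linarith
  -- The coupling from `w` into the controller does not shrink with `ε`. The weight `a` is chosen so
  -- that it uses only a quarter of the decay margin `1 - q` of the plant part.
  set a := 1 + 4 * k₃ / (1 - q) with ha
  have ha1 : 1 ≤ a := by rw [ha]; linarith [show 0 ≤ 4 * k₃ / (1 - q) by positivity]
  have hak : 4 * k₃ ≤ a * (1 - q) := by
    rw [ha, add_mul, div_mul_cancel₀ _ hq1'.ne']; linarith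
  -- The three bounds keep `I + ε S` contracting, keep the perturbation `ε L W` of `T` within
  -- another quarter of the margin, and keep the `ε²` feedback of `z` into `w` below half of the
  -- gain `κ ε`. Each `+ 1` only avoids division by zero.
  refine ⟨min ε₀ (min ((1 - q) / (4 * (k₁ + 1))) (κ / (2 * (a * k₂ + 1)))), by positivity,
    fun ε hε hle => ?_⟩
  have hle₀ : ε ≤ ε₀ := hle.trans (min_le_left _ _)
  have hle₁ : ε * k₁ ≤ (1 - q) / 4 := by
    have h := hle.trans ((min_le_right _ _).trans (min_le_left _ _))
    rw [le_div_iff₀ (by positivity)] at h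
    linarith
  have hle₂ : ε * (a * k₂) ≤ κ / 2 := by
    have h := hle.trans ((min_le_right _ _).trans (min_le_right _ _))
    rw [le_div_iff₀ (by positivity)] at h
    linarith
  have hεn : ‖(ε : ℂ)‖ = ε := by rw [Complex.norm_real, Real.norm_of_nonneg hε.le]
  have hεL : 0 ≤ ε * ‖L‖ := by positivity
  -- The Lyapunov function weighs the deviation of the plant from its quasi-steady state `ε L z`
  -- against the controller state. The equivalence constants may depend on `ε`, which is fixed here.
  refine powerStable_of_seminorm _ (fun v => a * p (v.1 - (ε : ℂ) • L v.2) + σ v.2)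
    (c₀ := (1 + ε * ‖L‖)⁻¹) (c₁ := a * (c * (1 + ε * ‖L‖)) + c')
    (q := max ((1 + q) / 2) (1 - κ * ε / 2)) (by positivity) (by positivity)
    (lt_max_of_lt_left (by linarith)) (max_lt (by linarith) (by linarith [mul_pos hκ hε]))
    ?_ ?_ ?_
  · rintro ⟨x, z⟩
    rw [inv_mul_le_iff₀ (by positivity)]
    have h1 := hp1 (x - (ε : ℂ) • L z)
    have h2 := hσ1 z
    have h3 : p (x - (ε : ℂ) • L z) ≤ a * p (x - (ε : ℂ) • L z) :=
      le_mul_of_one_le_left (apply_nonneg p _) ha1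
    have h4 : ‖x‖ ≤ ‖x - (ε : ℂ) • L z‖ + ε * ‖L‖ * ‖z‖ := by
      calc ‖x‖ = ‖(x - (ε : ℂ) • L z) + (ε : ℂ) • L z‖ := by rw [sub_add_cancel]
        _ ≤ ‖x - (ε : ℂ) • L z‖ + ‖(ε : ℂ) • L z‖ := norm_add_le _ _
        _ ≤ _ := by
          rw [norm_smul, hεn, mul_assoc]
          gcongr
          exact L.le_opNorm z
    have h5 : ε * ‖L‖ * ‖z‖ ≤ ε * ‖L‖ * σ z := mul_le_mul_of_nonneg_left h2 hεL
    have h6 : 0 ≤ ε * ‖L‖ * (a * p (x - (ε : ℂ) • L z)) := by positivity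
    have h7 : 0 ≤ σ z := apply_nonneg σ z
    have h8 : 0 ≤ p (x - (ε : ℂ) • L z) := apply_nonneg p _
    have h9 : 0 ≤ ε * ‖L‖ * σ z := by positivity
    rw [Prod.norm_def]
    refine max_le ?_ ?_ <;> simp only <;> linarith
  · rintro ⟨x, z⟩
    have hx : ‖x‖ ≤ ‖(x, z)‖ := norm_fst_le (x, z)
    have hz : ‖z‖ ≤ ‖(x, z)‖ := norm_snd_le (x, z)
    have h1 : ‖x - (ε : ℂ) • L z‖ ≤ (1 + ε * ‖L‖) * ‖(x, z)‖ := by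
      refine (norm_sub_le _ _).trans ?_
      rw [norm_smul, hεn, add_mul, one_mul, mul_assoc]
      gcongr
      exact (L.le_opNorm z).trans (mul_le_mul_of_nonneg_left hz (norm_nonneg _))
    have h2 : p (x - (ε : ℂ) • L z) ≤ c * ((1 + ε * ‖L‖) * ‖(x, z)‖) :=
      (hp2 _).trans (mul_le_mul_of_nonneg_left h1 hc.le)
    have h3 : σ z ≤ c' * ‖(x, z)‖ := (hσ2 z).trans (mul_le_mul_of_nonneg_left hz hc'.le)
    have h4 := mul_le_mul_of_nonneg_left h2 (zero_le_one.trans ha1)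
    simp only
    linarith
  · rintro ⟨x, z⟩
    simp only [blockOp_apply, add_apply, smul_apply, one_apply_eq_self]
    set w := x - (ε : ℂ) • L z with hw
    have hxw : x = w + (ε : ℂ) • L z := by rw [hw, sub_add_cancel]
    have hz' : W x + (z + (ε : ℂ) • d z) = (z + (ε : ℂ) • S z) + W w := by
      rw [hxw, hSdef]
      simp only [map_add, map_smul, add_apply, ContinuousLinearMap.comp_apply, smul_add]
      abel
    -- The equation for `L` cancels the `ε b z` term; what remains in the `w` component is `T w`, an
    -- `ε` perturbation of it, and a term of order `ε²` in `z`.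
    have hx' : T x + (ε : ℂ) • b z - (ε : ℂ) • L (z + (ε : ℂ) • S z + W w) =
        T w - (ε : ℂ) • (L ∘L W) w - (ε : ℂ) • (ε : ℂ) • (L ∘L S) z := by
      rw [map_add, map_add, hL z, hxw]
      simp only [map_add, map_smul, ContinuousLinearMap.comp_apply, smul_add]
      abel
    rw [hz', hx']
    have e1 : p (T w - (ε : ℂ) • (L ∘L W) w - (ε : ℂ) • (ε : ℂ) • (L ∘L S) z) ≤
        q * p w + ε * (k₁ * p w) + ε * (ε * (k₂ * σ z)) := by
      refine (map_sub_le_add p _ _).trans (add_le_add ((map_sub_le_add p _ _).trans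
        (add_le_add (hp3 w) ?_)) ?_)
      · rw [map_smul_eq_mul, hεn]
        refine mul_le_mul_of_nonneg_left ((hp2 _).trans ?_) hε.le
        rw [hk₁, mul_assoc]
        exact mul_le_mul_of_nonneg_left (((L ∘L W).le_opNorm w).trans
          (mul_le_mul_of_nonneg_left (hp1 w) (norm_nonneg _))) hc.le
      · rw [map_smul_eq_mul, map_smul_eq_mul, hεn]
        refine mul_le_mul_of_nonneg_left (mul_le_mul_of_nonneg_left
          ((hp2 _).trans ?_) hε.le) hε.le
        rw [hk₂, mul_assoc]
        exact mul_le_mul_of_nonneg_left (((L ∘L S).le_opNorm z).trans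
          (mul_le_mul_of_nonneg_left (hσ1 z) (norm_nonneg _))) hc.le
    have e2 : σ (z + (ε : ℂ) • S z + W w) ≤ (1 - κ * ε) * σ z + k₃ * p w := by
      refine (map_add_le_add σ _ _).trans (add_le_add (hσ3 ε hε hle₀ z) ((hσ2 _).trans ?_))
      rw [hk₃, mul_assoc]
      exact mul_le_mul_of_nonneg_left ((W.le_opNorm w).trans
        (mul_le_mul_of_nonneg_left (hp1 w) (norm_nonneg _))) hc'.le
    have hpw : 0 ≤ p w := apply_nonneg p w
    have hσz : 0 ≤ σ z := apply_nonneg σ z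
    have ha0 : 0 ≤ a := zero_le_one.trans ha1
    have f1 : a * (ε * (k₁ * p w)) ≤ a * ((1 - q) / 4 * p w) := by
      rw [← mul_assoc ε]; gcongr
    have f2 : a * (ε * (ε * (k₂ * σ z))) ≤ ε * (κ / 2 * σ z) := by
      calc a * (ε * (ε * (k₂ * σ z))) = ε * (ε * (a * k₂) * σ z) := by ring
        _ ≤ _ := by gcongr
    have f3 : 4 * k₃ * p w ≤ a * (1 - q) * p w := mul_le_mul_of_nonneg_right hak hpw
    have f4 := mul_le_mul_of_nonneg_left e1 ha0
    have g1 : (1 + q) / 2 * (a * p w) ≤ max ((1 + q) / 2) (1 - κ * ε / 2) * (a * p w) :=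
      mul_le_mul_of_nonneg_right (le_max_left _ _) (by positivity)
    have g2 : (1 - κ * ε / 2) * σ z ≤ max ((1 + q) / 2) (1 - κ * ε / 2) * σ z :=
      mul_le_mul_of_nonneg_right (le_max_right _ _) hσz
    -- Budget: the plant part gets `q + (1 - q)/4 + (1 - q)/4 = (1 + q)/2`, the controller part `1 -
    -- κ ε + κ ε / 2`.
    rw [mul_add]
    refine le_trans ?_ (add_le_add g1 g2)
    linarith

end BlockOperator

/-! ### The lifted closed-loop system and its trajectories -/

section LiftedSystem

variable {τ : ℝ} {X U₀ Ud₀ Y₀ Z : Type*}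
  [NormedAddCommGroup X] [NormedSpace ℂ X] [CompleteSpace X]
  [NormedAddCommGroup U₀] [InnerProductSpace ℂ U₀]
  [NormedAddCommGroup Ud₀] [InnerProductSpace ℂ Ud₀]
  [NormedAddCommGroup Y₀] [InnerProductSpace ℂ Y₀]
  [NormedAddCommGroup Z] [NormedSpace ℂ Z]

namespace PeriodicSystem

noncomputable section

/-- Effect of the control over one period on the state at the end of the period. -/
def inputOp (sys : PeriodicSystem τ X U₀ Ud₀ Y₀) : L2 τ U₀ →L[ℂ] X :=
  sys.terminalOp ∘L mulOp τ sys.B sys.memLp_B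

/-- Effect of the disturbance over one period on the state at the end of the period. -/
def distInputOp (sys : PeriodicSystem τ X U₀ Ud₀ Y₀) : L2 τ Ud₀ →L[ℂ] X :=
  sys.terminalOp ∘L mulOp τ sys.Bd sys.memLp_Bd

/-- Output over one period of the free motion. -/
def outputOp (sys : PeriodicSystem τ X U₀ Ud₀ Y₀) : X →L[ℂ] L2 τ Y₀ :=
  mulOp τ sys.C sys.memLp_C ∘L sys.freeOp

/-- Output over one period that the control generates from the zero state. -/
def feedthroughOp (sys : PeriodicSystem τ X U₀ Ud₀ Y₀) : L2 τ U₀ →L[ℂ] L2 τ Y₀ :=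
  mulOp τ sys.C sys.memLp_C ∘L sys.forcedOp ∘L mulOp τ sys.B sys.memLp_B + mulOp τ sys.D sys.memLp_D

/-- Output over one period that the disturbance generates from the zero state. -/
def distFeedthroughOp (sys : PeriodicSystem τ X U₀ Ud₀ Y₀) : L2 τ Ud₀ →L[ℂ] L2 τ Y₀ :=
  mulOp τ sys.C sys.memLp_C ∘L sys.forcedOp ∘L mulOp τ sys.Bd sys.memLp_Bd

/-- `𝒫` is the transfer function of the lifted plant at the point `1`, which is how the spectral
hypothesis enters the low-gain argument. -/
theorem P_apply (sys : PeriodicSystem τ X U₀ Ud₀ Y₀) (u : L2 τ U₀) :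
    sys.P u = sys.outputOp (sys.monodromyResolvent (sys.inputOp u)) + sys.feedthroughOp u := by
  simp only [P, PeriodicEvolutionFamily.steadyStateOp_eq, outputOp, inputOp, feedthroughOp, add_apply,
    ContinuousLinearMap.comp_apply, map_add]
  abel

theorem Pd_apply (sys : PeriodicSystem τ X U₀ Ud₀ Y₀) (w : L2 τ Ud₀) :
    sys.Pd w =
      sys.outputOp (sys.monodromyResolvent (sys.distInputOp w)) + sys.distFeedthroughOp w := by
  simp only [Pd, PeriodicEvolutionFamily.steadyStateOp_eq, outputOp, distInputOp, distFeedthroughOp,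
    add_apply, ContinuousLinearMap.comp_apply, map_add]

/-- The forcing of the state equation over one period. -/
def forcing (sys : PeriodicSystem τ X U₀ Ud₀ Y₀) (u : L2 τ U₀) (w : L2 τ Ud₀) : L2 τ X :=
  mulOp τ sys.B sys.memLp_B u + mulOp τ sys.Bd sys.memLp_Bd w

theorem terminalOp_forcing (sys : PeriodicSystem τ X U₀ Ud₀ Y₀) (u : L2 τ U₀) (w : L2 τ Ud₀) :
    sys.terminalOp (sys.forcing u w) = sys.inputOp u + sys.distInputOp w :=
  map_add _ _ _

section Mild

variable (sys : PeriodicSystem τ X U₀ Ud₀ Y₀) {x : ℝ → X} {u : ℝ → U₀} {v : ℕ → L2 τ U₀}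
  {wd : PeriodicSignal τ Ud₀} {x₀ : X}
  (hu : ∀ n : ℕ, (fun s => u (n * τ + s)) =ᵐ[periodMeasure τ] v n)
  (hx : ∀ t, 0 ≤ t → x t = sys.evol t 0 x₀ +
    ∫ s in (0 : ℝ)..t, sys.evol t s (sys.B s (u s) + sys.Bd s (wd s)))
include hu

omit [CompleteSpace X] in
theorem forcing_ae_eq (n : ℕ) :
    (fun s => sys.B (n * τ + s) (u (n * τ + s)) + sys.Bd (n * τ + s) (wd (n * τ + s)))
      =ᵐ[periodMeasure τ] sys.forcing (v n) wd.toL2 := by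
  filter_upwards [hu n, wd.memLp.coeFn_toLp, coeFn_mulOp τ sys.B sys.memLp_B (v n),
    coeFn_mulOp τ sys.Bd sys.memLp_Bd wd.toL2,
    Lp.coeFn_add (mulOp τ sys.B sys.memLp_B (v n)) (mulOp τ sys.Bd sys.memLp_Bd wd.toL2)]
    with s h1 h2 h3 h4 h5
  have hB := sys.periodic_B.nat_mul n s
  have hBd := sys.periodic_Bd.nat_mul n s
  have hw := wd.periodic.nat_mul n s
  rw [add_comm] at hB hBd hw
  refine Eq.trans ?_ h5.symm
  rw [Pi.add_apply, h3, h4, h1, hB, hBd, hw]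
  congr 2
  exact h2.symm

include hx

theorem mild_period (n : ℕ) {t : ℝ} (ht : t ∈ Icc 0 τ) :
    x (n * τ + t) = sys.evol t 0 (x (n * τ)) +
      ∫ s in (0 : ℝ)..t, sys.evol t s (sys.forcing (v n) wd.toL2 s) := by
  rw [sys.mild_add_period (f := fun s => sys.B s (u s) + sys.Bd s (wd s))
    (fun n => (integrable_coeFn_L2 _).congr (sys.forcing_ae_eq hu n).symm) hx n ht.1]
  congr 1
  rw [intervalIntegral.integral_of_le ht.1, intervalIntegral.integral_of_le ht.1]
  refine integral_congr_ae ?_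
  filter_upwards [ae_restrict_of_ae_restrict_of_subset (Ioc_subset_Ioc_right ht.2)
    (sys.forcing_ae_eq (wd := wd) hu n)] with s hs
  exact congrArg _ hs

theorem mild_succ (n : ℕ) : x ((n + 1 : ℕ) * τ) =
    sys.evol τ 0 (x (n * τ)) + (sys.inputOp (v n) + sys.distInputOp wd.toL2) := by
  rw [← terminalOp_forcing, sys.terminalOp_apply,
    ← sys.mild_period hu hx n ⟨sys.period_pos.le, le_rfl⟩]
  congr 1
  push_cast
  ring

theorem output_ae_eq (n : ℕ) :
    (fun s => sys.C (n * τ + s) (x (n * τ + s)) + sys.D (n * τ + s) (u (n * τ + s)))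
      =ᵐ[periodMeasure τ] (sys.outputOp (x (n * τ)) + sys.feedthroughOp (v n) +
        sys.distFeedthroughOp wd.toL2 : L2 τ Y₀) := by
  set g := sys.forcing (v n) wd.toL2 with hg
  have hsum : sys.outputOp (x (n * τ)) + sys.feedthroughOp (v n) +
      sys.distFeedthroughOp wd.toL2 = mulOp τ sys.C sys.memLp_C
        (sys.freeOp (x (n * τ)) + sys.forcedOp g) + mulOp τ sys.D sys.memLp_D (v n) := by
    simp only [hg, forcing, outputOp, feedthroughOp, distFeedthroughOp, add_apply,
      ContinuousLinearMap.comp_apply, map_add]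
    abel
  rw [hsum]
  filter_upwards [hu n, coeFn_mulOp τ sys.C sys.memLp_C
      (sys.freeOp (x (n * τ)) + sys.forcedOp g),
    coeFn_mulOp τ sys.D sys.memLp_D (v n), sys.coeFn_freeOp (x (n * τ)), sys.coeFn_forcedOp g,
    Lp.coeFn_add (sys.freeOp (x (n * τ))) (sys.forcedOp g),
    Lp.coeFn_add (mulOp τ sys.C sys.memLp_C (sys.freeOp (x (n * τ)) + sys.forcedOp g))
      (mulOp τ sys.D sys.memLp_D (v n)), ae_restrict_mem measurableSet_Ioc]
    with s h1 h2 h3 h4 h5 h6 h7 hs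
  have hC := sys.periodic_C.nat_mul n s
  have hD := sys.periodic_D.nat_mul n s
  rw [add_comm] at hC hD
  refine Eq.trans ?_ h7.symm
  rw [Pi.add_apply, h2, h3, h6, Pi.add_apply, h4, h5, h1, hC, hD,
    sys.mild_period hu hx n ⟨hs.1.le, hs.2⟩]

end Mild

/-- One step of the lifted closed-loop system. -/
def closedLoopOp (sys : PeriodicSystem τ X U₀ Ud₀ Y₀) (ctrl : Controller τ U₀ Y₀ Z) :
    X × Z →L[ℂ] X × Z :=
  blockOp (sys.evol τ 0) (sys.inputOp ∘L ctrl.K) (ctrl.G₂ ∘L sys.outputOp)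
    (ctrl.G₁ + ctrl.G₂ ∘L sys.feedthroughOp ∘L ctrl.K)

/-- The output of the lifted closed-loop system without exogenous signals. -/
def closedLoopOutput (sys : PeriodicSystem τ X U₀ Ud₀ Y₀) (ctrl : Controller τ U₀ Y₀ Z) :
    X × Z →L[ℂ] L2 τ Y₀ :=
  sys.outputOp ∘L ContinuousLinearMap.fst ℂ X Z +
    (sys.feedthroughOp ∘L ctrl.K) ∘L ContinuousLinearMap.snd ℂ X Z

/-- The direct effect of disturbance and reference on the regulation error. -/
def exoError (sys : PeriodicSystem τ X U₀ Ud₀ Y₀) (w : L2 τ Ud₀) (y : L2 τ Y₀) : L2 τ Y₀ :=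
  sys.distFeedthroughOp w - y

/-- The forcing of the lifted closed-loop system. -/
def closedLoopForcing (sys : PeriodicSystem τ X U₀ Ud₀ Y₀) (ctrl : Controller τ U₀ Y₀ Z)
    (w : L2 τ Ud₀) (y : L2 τ Y₀) : X × Z :=
  (sys.distInputOp w, ctrl.G₂ (sys.exoError w y))

theorem closedLoopOp_add_forcing_fst (sys : PeriodicSystem τ X U₀ Ud₀ Y₀)
    (ctrl : Controller τ U₀ Y₀ Z) (ξ : X × Z) (w : L2 τ Ud₀) (y : L2 τ Y₀) :
    (sys.closedLoopOp ctrl ξ + sys.closedLoopForcing ctrl w y).1 =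
      sys.evol τ 0 ξ.1 + (sys.inputOp (ctrl.K ξ.2) + sys.distInputOp w) := by
  simp [closedLoopOp, closedLoopForcing, add_assoc]

theorem closedLoopOp_add_forcing_snd (sys : PeriodicSystem τ X U₀ Ud₀ Y₀)
    (ctrl : Controller τ U₀ Y₀ Z) (ξ : X × Z) (w : L2 τ Ud₀) (y : L2 τ Y₀) :
    (sys.closedLoopOp ctrl ξ + sys.closedLoopForcing ctrl w y).2 =
      ctrl.G₁ ξ.2 + ctrl.G₂ (sys.closedLoopOutput ctrl ξ + sys.exoError w y) := by
  simp only [closedLoopOp, closedLoopForcing, closedLoopOutput, blockOp_apply, Prod.snd_add,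
    add_apply, ContinuousLinearMap.comp_apply, map_add, ContinuousLinearMap.coe_fst',
    ContinuousLinearMap.coe_snd']
  abel

end

end PeriodicSystem

namespace ClosedLoopTrajectory

variable {sys : PeriodicSystem τ X U₀ Ud₀ Y₀} {ctrl : Controller τ U₀ Y₀ Z}
  {yref : PeriodicSignal τ Y₀} {wd : PeriodicSignal τ Ud₀} {x0 : X} {z0 : Z}

/-- The state of the lifted system: plant and controller state at the beginning of a period. -/
def lifted (T : ClosedLoopTrajectory sys ctrl yref wd x0 z0) (n : ℕ) : X × Z :=
  (T.x (n * τ), T.z n)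

omit [CompleteSpace X] in
theorem lifted_zero (T : ClosedLoopTrajectory sys ctrl yref wd x0 z0) : T.lifted 0 = (x0, z0) := by
  have h := T.state_eq 0 le_rfl
  rw [intervalIntegral.integral_same, sys.evol_self, add_zero] at h
  simp [lifted, h, T.z_zero]

theorem error_formula (T : ClosedLoopTrajectory sys ctrl yref wd x0 z0) (n : ℕ) :
    T.e n = sys.closedLoopOutput ctrl (T.lifted n) + sys.exoError wd.toL2 yref.toL2 := by
  have hτ := sys.period_pos
  have h : sys.closedLoopOutput ctrl (T.lifted n) + sys.exoError wd.toL2 yref.toL2 =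
      sys.outputOp (T.x (n * τ)) + sys.feedthroughOp (ctrl.K (T.z n)) +
        sys.distFeedthroughOp wd.toL2 - yref.toL2 := by
    simp only [PeriodicSystem.closedLoopOutput, PeriodicSystem.exoError, lifted, add_apply,
      ContinuousLinearMap.comp_apply, ContinuousLinearMap.coe_fst', ContinuousLinearMap.coe_snd']
    abel
  rw [h]
  refine Lp.ext ?_
  filter_upwards [T.error_eq n, sys.output_ae_eq T.control_eq T.state_eq n,
    yref.memLp.coeFn_toLp, Lp.coeFn_sub (sys.outputOp (T.x (n * τ)) +
      sys.feedthroughOp (ctrl.K (T.z n)) + sys.distFeedthroughOp wd.toL2) yref.toL2,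
    ae_restrict_mem measurableSet_Ioc] with s h1 h2 h3 h4 hs
  rw [h1, h4, Pi.sub_apply, ← h2, T.output_eq _ (add_nonneg (by positivity) hs.1.le)]
  exact congrArg _ h3.symm

/-- This reduces every asymptotic statement on trajectories to the iteration of one affine map on `X
× Z`. -/
theorem lifted_succ (T : ClosedLoopTrajectory sys ctrl yref wd x0 z0) (n : ℕ) :
    T.lifted (n + 1) = sys.closedLoopOp ctrl (T.lifted n) +
      sys.closedLoopForcing ctrl wd.toL2 yref.toL2 := by
  refine Prod.ext ?_ ?_
  · rw [sys.closedLoopOp_add_forcing_fst]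
    exact sys.mild_succ T.control_eq T.state_eq n
  · rw [sys.closedLoopOp_add_forcing_snd, ← T.error_formula]
    exact T.z_succ n

end ClosedLoopTrajectory

/-- The concatenation of functions on `(0, τ]` to a function on `(0, ∞)`. -/
noncomputable def concatPeriods {V : Type*} (τ : ℝ) (v : ℕ → ℝ → V) (t : ℝ) : V :=
  -- Periods are closed on the right, hence ceiling minus one. For `t ≤ 0` the truncated subtraction
  -- yields index `0`.
  v (⌈t / τ⌉₊ - 1) (t - (⌈t / τ⌉₊ - 1 : ℕ) * τ)

theorem concatPeriods_add {V : Type*} {τ : ℝ} (hτ : 0 < τ) (v : ℕ → ℝ → V) (n : ℕ) {s : ℝ}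
    (hs : s ∈ Ioc 0 τ) : concatPeriods τ v (n * τ + s) = v n s := by
  have h : ⌈(n * τ + s) / τ⌉₊ = n + 1 := by
    rw [Nat.ceil_eq_iff (by simp), lt_div_iff₀ hτ, div_le_iff₀ hτ, Nat.add_sub_cancel]
    push_cast
    constructor <;> linarith [hs.1, hs.2]
  simp [concatPeriods, h]

/-- The closed loop always has trajectories: they are built period by period. -/
theorem closedLoopWellPosed (sys : PeriodicSystem τ X U₀ Ud₀ Y₀) (ctrl : Controller τ U₀ Y₀ Z) :
    ClosedLoopWellPosed sys ctrl := by
  intro yref wd x0 z0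
  have hτ := sys.period_pos
  -- No fixed-point problem arises: the control on a period depends only on the controller state at
  -- its start. So the lifted recursion is solved first, its controls are glued together, and the
  -- mild formula defines the state.
  let ξ : ℕ → X × Z := fun n => Nat.rec (x0, z0) (fun _ ξ => sys.closedLoopOp ctrl ξ +
    sys.closedLoopForcing ctrl wd.toL2 yref.toL2) n
  have hξ : ∀ n, ξ (n + 1) = sys.closedLoopOp ctrl (ξ n) +
    sys.closedLoopForcing ctrl wd.toL2 yref.toL2 := fun _ => rfl
  let u : ℝ → U₀ := concatPeriods τ fun n => ctrl.K (ξ n).2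
  let x : ℝ → X := fun t => sys.evol t 0 x0 +
    ∫ s in (0 : ℝ)..t, sys.evol t s (sys.B s (u s) + sys.Bd s (wd s))
  have hu : ∀ n : ℕ, (fun s => u (n * τ + s)) =ᵐ[periodMeasure τ] ctrl.K (ξ n).2 := fun n => by
    filter_upwards [ae_restrict_mem measurableSet_Ioc] with s hs
    exact concatPeriods_add hτ _ n hs
  have hx : ∀ t, 0 ≤ t → x t = sys.evol t 0 x0 +
    ∫ s in (0 : ℝ)..t, sys.evol t s (sys.B s (u s) + sys.Bd s (wd s)) := fun _ _ => rfl
  have hxξ : ∀ n : ℕ, x (n * τ) = (ξ n).1 := by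
    intro n
    induction n with
    | zero => simp [x, ξ, sys.evol_self]
    | succ n ih => rw [sys.mild_succ hu hx n, ih, hξ, sys.closedLoopOp_add_forcing_fst]
  have hz := fun n => (congrArg Prod.snd (hξ n)).trans
    (sys.closedLoopOp_add_forcing_snd ctrl (ξ n) wd.toL2 yref.toL2)
  refine ⟨⟨x, fun t => sys.C t (x t) + sys.D t (u t), u, fun n => (ξ n).2,
    fun n => sys.closedLoopOutput ctrl (ξ n) + sys.exoError wd.toL2 yref.toL2,
    hx, fun _ _ => rfl, hu, fun n => ?_, rfl, hz⟩⟩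
  have h : sys.closedLoopOutput ctrl (ξ n) + sys.exoError wd.toL2 yref.toL2 =
      sys.outputOp (x (n * τ)) + sys.feedthroughOp (ctrl.K (ξ n).2) +
        sys.distFeedthroughOp wd.toL2 - yref.toL2 := by
    rw [hxξ]
    simp only [PeriodicSystem.closedLoopOutput, PeriodicSystem.exoError, add_apply,
      ContinuousLinearMap.comp_apply, ContinuousLinearMap.coe_fst', ContinuousLinearMap.coe_snd']
    abel
  rw [h]
  filter_upwards [sys.output_ae_eq hu hx n, yref.memLp.coeFn_toLp,
    Lp.coeFn_sub (sys.outputOp (x (n * τ)) +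
      sys.feedthroughOp (ctrl.K (ξ n).2) + sys.distFeedthroughOp wd.toL2) yref.toL2]
    with s h2 h3 h4
  rw [h4, Pi.sub_apply, ← h2]
  exact congrArg _ h3

end LiftedSystem

/-! ### Closed-loop stability as power stability -/

section ClosedLoopStability

variable {τ : ℝ} {X U₀ Ud₀ Y₀ Z : Type*}
  [NormedAddCommGroup X] [NormedSpace ℂ X] [CompleteSpace X]
  [NormedAddCommGroup U₀] [InnerProductSpace ℂ U₀]
  [NormedAddCommGroup Ud₀] [InnerProductSpace ℂ Ud₀]
  [NormedAddCommGroup Y₀] [InnerProductSpace ℂ Y₀]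
  [NormedAddCommGroup Z] [NormedSpace ℂ Z]

omit [CompleteSpace X] in
theorem PeriodicEvolutionFamily.ExponentiallyStable.powerStable
    {E : PeriodicEvolutionFamily τ X} (hE : E.ExponentiallyStable) : PowerStable (E.evol τ 0) := by
  have hτ := E.period_pos
  obtain ⟨M, hM, ω, hω, h⟩ := hE
  refine ⟨M, hM, Real.exp (-(ω * τ)), Real.exp_pos _, Real.exp_lt_one_iff.2 (by nlinarith),
    fun n x => ?_⟩
  rw [← E.evol_nat_mul, ← Real.exp_nat_mul]
  refine ContinuousLinearMap.le_of_opNorm_le _ ((h (n * τ) 0 (by positivity)).trans (le_of_eq ?_)) _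
  ring_nf

omit [CompleteSpace X] in
theorem PeriodicEvolutionFamily.monodromyResolvent_eq_of_isUnit {E : PeriodicEvolutionFamily τ X}
    (hE : IsUnit (1 - E.evol τ 0)) {x f : X} (hx : x = E.evol τ 0 x + f) :
    x = E.monodromyResolvent f := by
  have h1 := congrArg (fun A => A x) (Ring.inverse_mul_cancel _ hE)
  have h2 : (1 - E.evol τ 0) x = f := by
    rw [sub_apply, one_apply_eq_self, sub_eq_iff_eq_add']
    exact hx
  simp only [mul_apply_eq_comp, one_apply_eq_self, h2] at h1
  exact h1.symm

omit [CompleteSpace X] in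
theorem PeriodicEvolutionFamily.monodromyResolvent_apply_eq {E : PeriodicEvolutionFamily τ X}
    (hE : IsUnit (1 - E.evol τ 0)) (f : X) :
    E.monodromyResolvent f = E.evol τ 0 (E.monodromyResolvent f) + f := by
  have h := congrArg (fun A => A f) (Ring.mul_inverse_cancel _ hE)
  simp only [mul_apply_eq_comp, one_apply_eq_self, sub_apply] at h
  rw [← sub_eq_iff_eq_add']
  exact h

theorem exp_neg_neg_log_mul {ρ : ℝ} (hρ : 0 < ρ) (n : ℕ) :
    Real.exp (-(-Real.log ρ) * n) = ρ ^ n := by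
  rw [neg_neg, mul_comm, Real.exp_nat_mul, Real.exp_log hρ]

@[simp]
theorem PeriodicSignal.toL2_zero {V : Type*} [NormedAddCommGroup V] :
    (0 : PeriodicSignal τ V).toL2 = 0 :=
  MemLp.toLp_zero _

theorem ClosedLoopTrajectory.lifted_eq_pow {sys : PeriodicSystem τ X U₀ Ud₀ Y₀}
    {ctrl : Controller τ U₀ Y₀ Z} {x0 : X} {z0 : Z} (T : ClosedLoopTrajectory sys ctrl 0 0 x0 z0)
    (n : ℕ) : T.lifted n = (sys.closedLoopOp ctrl ^ n) (x0, z0) := by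
  have h0 : sys.closedLoopForcing ctrl (0 : PeriodicSignal τ Ud₀).toL2
      (0 : PeriodicSignal τ Y₀).toL2 = 0 := by
    simp [PeriodicSystem.closedLoopForcing, PeriodicSystem.exoError]
  have h := affine_iterate_sub_fixedPoint (v' := 0) T.lifted_succ (by rw [h0]; simp) n
  simpa [T.lifted_zero] using h

/-- Between the sampling instants the plant state is controlled by the lifted state. -/
theorem ClosedLoopTrajectory.exists_intersample_bound (sys : PeriodicSystem τ X U₀ Ud₀ Y₀)
    (ctrl : Controller τ U₀ Y₀ Z) :
    ∃ c > 0, ∀ (x0 : X) (z0 : Z) (T : ClosedLoopTrajectory sys ctrl 0 0 x0 z0) (n : ℕ),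
      ∀ t ∈ Icc 0 τ, ‖T.x (n * τ + t)‖ ≤ c * ‖T.lifted n‖ := by
  obtain ⟨M, hM⟩ := sys.exists_bound
  obtain ⟨c, hc0, hc⟩ := sys.exists_forced_bound
  set b := mulOp τ sys.B sys.memLp_B ∘L ctrl.K
  refine ⟨M + c * ‖b‖ + 1, by positivity, fun x0 z0 T n t ht => ?_⟩
  have hx : ‖T.x (n * τ)‖ ≤ ‖T.lifted n‖ := norm_fst_le (T.lifted n)
  have hz : ‖T.z n‖ ≤ ‖T.lifted n‖ := norm_snd_le (T.lifted n)
  have hf : sys.forcing (ctrl.K (T.z n)) (0 : PeriodicSignal τ Ud₀).toL2 = b (T.z n) := by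
    simp [PeriodicSystem.forcing, b]
  rw [sys.mild_period T.control_eq T.state_eq n ht, hf, add_mul, add_mul, one_mul]
  refine le_add_of_le_of_nonneg ((norm_add_le _ _).trans (add_le_add ?_ ?_)) (norm_nonneg _)
  · exact (ContinuousLinearMap.le_of_opNorm_le _ (hM t 0 le_rfl ht.1 ht.2) _).trans
      (mul_le_mul_of_nonneg_left hx M.2)
  · rw [mul_assoc]
    exact (hc _ t ht).trans (mul_le_mul_of_nonneg_left ((b.le_opNorm _).trans
      (mul_le_mul_of_nonneg_left hz (norm_nonneg _))) hc0)

theorem norm_prod_le_add {V W : Type*} [NormedAddCommGroup V] [NormedAddCommGroup W]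
    (x : V) (z : W) : ‖(x, z)‖ ≤ ‖x‖ + ‖z‖ :=
  max_le (le_add_of_nonneg_right (norm_nonneg _)) (le_add_of_nonneg_left (norm_nonneg _))

/-- Decay at the sampling instants passes to all times through the uniform intersample bound. -/
theorem closedLoopStable_of_powerStable {sys : PeriodicSystem τ X U₀ Ud₀ Y₀}
    {ctrl : Controller τ U₀ Y₀ Z} (h : PowerStable (sys.closedLoopOp ctrl)) :
    ClosedLoopStable sys ctrl := by
  have hτ := sys.period_pos
  obtain ⟨M, hM, ρ, hρ, hρ1, h⟩ := h
  obtain ⟨c, hc, hcT⟩ := ClosedLoopTrajectory.exists_intersample_bound sys ctrl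
  have hlog : 0 < -Real.log ρ := neg_pos.2 (Real.log_neg hρ hρ1)
  have hbd : ∀ (x0 : X) (z0 : Z) (T : ClosedLoopTrajectory sys ctrl 0 0 x0 z0) (n : ℕ),
      ‖T.lifted n‖ ≤ M * ρ ^ n * (‖x0‖ + ‖z0‖) := fun x0 z0 T n => by
    rw [T.lifted_eq_pow]
    exact (h n _).trans (mul_le_mul_of_nonneg_left (norm_prod_le_add _ _) (by positivity))
  -- The factor `ρ⁻¹` pays for rounding `t / τ` down to `n`, which loses at most one step.
  refine ⟨c * M * ρ⁻¹, by positivity, M, hM, -Real.log ρ / τ, by positivity, -Real.log ρ, hlog,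
    fun x0 z0 T => ⟨fun t ht => ?_, fun n => ?_⟩⟩
  · set n := ⌊t / τ⌋₊ with hn
    have hn1 : n * τ ≤ t := by
      rw [← le_div_iff₀ hτ]
      exact Nat.floor_le (by positivity)
    have hn2 : t / τ ≤ n + 1 := (Nat.lt_floor_add_one _).le
    have hn3 : t ≤ n * τ + τ := by
      rw [div_le_iff₀ hτ] at hn2
      linarith
    have h1 := hcT x0 z0 T n (t - n * τ) ⟨by linarith, by linarith⟩
    rw [add_sub_cancel] at h1
    have h2 : ρ ^ n ≤ ρ⁻¹ * Real.exp (-(-Real.log ρ / τ) * t) := by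
      have h3 : ρ⁻¹ = Real.exp (-Real.log ρ) := by rw [Real.exp_neg, Real.exp_log hρ]
      rw [← exp_neg_neg_log_mul hρ, h3, ← Real.exp_add, Real.exp_le_exp]
      have h4 := mul_le_mul_of_nonneg_left hn2 hlog.le
      have h5 : -Real.log ρ / τ * t = -Real.log ρ * (t / τ) := by ring
      linarith
    calc ‖T.x t‖ ≤ c * ‖T.lifted n‖ := h1
      _ ≤ c * (M * (ρ⁻¹ * Real.exp (-(-Real.log ρ / τ) * t)) * (‖x0‖ + ‖z0‖)) := by
        refine mul_le_mul_of_nonneg_left ((hbd x0 z0 T n).trans ?_) hc.le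
        gcongr
      _ = _ := by ring
  · rw [exp_neg_neg_log_mul hρ]
    exact (norm_snd_le (T.lifted n)).trans (hbd x0 z0 T n)

/-- `ClosedLoopStable` only speaks of given trajectories. Well-posedness supplies one from every
point of `X × Z`, and its lifted states are the powers of the closed-loop operator applied to that
point. -/
theorem powerStable_of_closedLoopStable {sys : PeriodicSystem τ X U₀ Ud₀ Y₀}
    {ctrl : Controller τ U₀ Y₀ Z} (h : ClosedLoopStable sys ctrl) :
    PowerStable (sys.closedLoopOp ctrl) := by
  have hτ := sys.period_pos
  obtain ⟨M₀, hM₀, M₁, hM₁, α₀, hα₀, α₁, hα₁, h⟩ := h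
  have hα : 0 < min (α₀ * τ) α₁ := lt_min (by positivity) hα₁
  -- The rate is the slower of the two given ones, measured per period; the `2` compares the sum of
  -- the norms with the maximum norm on the product.
  refine ⟨2 * (M₀ + M₁), by positivity, Real.exp (-min (α₀ * τ) α₁), Real.exp_pos _,
    Real.exp_lt_one_iff.2 (by linarith), fun n v => ?_⟩
  obtain ⟨T⟩ := closedLoopWellPosed sys ctrl 0 0 v.1 v.2
  have hT := T.lifted_eq_pow n
  obtain ⟨h1, h2⟩ := h v.1 v.2 T
  have h1 := h1 (n * τ) (by positivity)
  have h2 := h2 n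
  have hv : ‖v.1‖ + ‖v.2‖ ≤ 2 * ‖v‖ := by linarith [norm_fst_le v, norm_snd_le v]
  have e1 : Real.exp (-α₀ * (n * τ)) ≤ Real.exp (-min (α₀ * τ) α₁) ^ n := by
    rw [← Real.exp_nat_mul, Real.exp_le_exp]
    have := mul_le_mul_of_nonneg_left (min_le_left (α₀ * τ) α₁) (Nat.cast_nonneg (α := ℝ) n)
    linarith
  have e2 : Real.exp (-α₁ * n) ≤ Real.exp (-min (α₀ * τ) α₁) ^ n := by
    rw [← Real.exp_nat_mul, Real.exp_le_exp]
    have := mul_le_mul_of_nonneg_left (min_le_right (α₀ * τ) α₁) (Nat.cast_nonneg (α := ℝ) n)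
    linarith
  set ρ := Real.exp (-min (α₀ * τ) α₁)
  have hρ : 0 < ρ := Real.exp_pos _
  calc ‖(sys.closedLoopOp ctrl ^ n) v‖ = ‖T.lifted n‖ := by rw [hT]
    _ ≤ ‖T.x (n * τ)‖ + ‖T.z n‖ := norm_prod_le_add _ _
    _ ≤ M₀ * ρ ^ n * (2 * ‖v‖) + M₁ * ρ ^ n * (2 * ‖v‖) := by
      refine add_le_add (h1.trans ?_) (h2.trans ?_) <;> gcongr
    _ = _ := by ring

/-! ### Equilibria and the asymptotic regulation error -/

namespace PeriodicSystem

/-- The equilibrium of the lifted closed-loop system. -/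
noncomputable def equilibrium (sys : PeriodicSystem τ X U₀ Ud₀ Y₀) (ctrl : Controller τ U₀ Y₀ Z)
    (w : L2 τ Ud₀) (y : L2 τ Y₀) : X × Z :=
  Ring.inverse (1 - sys.closedLoopOp ctrl) (sys.closedLoopForcing ctrl w y)

/-- The limit of the regulation error. -/
noncomputable def asymptoticError (sys : PeriodicSystem τ X U₀ Ud₀ Y₀)
    (ctrl : Controller τ U₀ Y₀ Z) (w : L2 τ Ud₀) (y : L2 τ Y₀) : L2 τ Y₀ :=
  sys.closedLoopOutput ctrl (sys.equilibrium ctrl w y) + sys.exoError w y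

variable {sys : PeriodicSystem τ X U₀ Ud₀ Y₀} {ctrl : Controller τ U₀ Y₀ Z}

/-- Power stability makes `1 - closedLoopOp` a unit, so `Ring.inverse` is a genuine inverse here and
not its default value `0`. -/
theorem equilibrium_eq [CompleteSpace Z] (h : PowerStable (sys.closedLoopOp ctrl)) (w : L2 τ Ud₀)
    (y : L2 τ Y₀) : sys.equilibrium ctrl w y =
      sys.closedLoopOp ctrl (sys.equilibrium ctrl w y) + sys.closedLoopForcing ctrl w y := by
  have h1 := Ring.mul_inverse_cancel _ h.isUnit_one_sub
  have h2 := congrArg (fun A => A (sys.closedLoopForcing ctrl w y)) h1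
  simp only [mul_apply_eq_comp, sub_apply, one_apply_eq_self] at h2
  rw [← sub_eq_iff_eq_add']
  exact h2

theorem exists_equilibrium_bound (sys : PeriodicSystem τ X U₀ Ud₀ Y₀)
    (ctrl : Controller τ U₀ Y₀ Z) :
    ∃ c ≥ 0, ∀ w y, ‖sys.equilibrium ctrl w y‖ ≤ c * (‖w‖ + ‖y‖) := by
  set R := Ring.inverse (1 - sys.closedLoopOp ctrl) with hR
  set F := ctrl.G₂ ∘L sys.distFeedthroughOp with hF
  refine ⟨‖R‖ * (‖sys.distInputOp‖ + (‖F‖ + ‖ctrl.G₂‖)), by positivity, fun w y => ?_⟩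
  refine (R.le_opNorm _).trans ?_
  rw [mul_assoc]
  refine mul_le_mul_of_nonneg_left ((norm_prod_le_add _ _).trans ?_) (norm_nonneg _)
  have h1 := sys.distInputOp.le_opNorm w
  have h2 : ‖ctrl.G₂ (sys.exoError w y)‖ ≤ ‖F‖ * ‖w‖ + ‖ctrl.G₂‖ * ‖y‖ := by
    rw [exoError, map_sub]
    exact (norm_sub_le _ _).trans (add_le_add (F.le_opNorm w) (ctrl.G₂.le_opNorm y))
  have h3 : 0 ≤ ‖sys.distInputOp‖ * ‖y‖ := by positivity
  have h4 : 0 ≤ ‖F‖ * ‖y‖ := by positivity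
  have h5 : 0 ≤ ‖ctrl.G₂‖ * ‖w‖ := by positivity
  linarith

/-- The error differs from its limit by the output of `A ^ n` applied to the initial distance from
the equilibrium. The linear bound on the equilibrium makes the constants uniform in the signals. -/
theorem errorConvergesTo_asymptoticError [CompleteSpace Z]
    (h : PowerStable (sys.closedLoopOp ctrl)) :
    ErrorConvergesTo sys ctrl fun yref wd => sys.asymptoticError ctrl wd.toL2 yref.toL2 := by
  obtain ⟨c, hc, hbd⟩ := exists_equilibrium_bound sys ctrl
  have hfix := equilibrium_eq h
  obtain ⟨M, hM, ρ, hρ, hρ1, hpow⟩ := h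
  set O := sys.closedLoopOutput ctrl with hO
  refine ⟨(‖O‖ + 1) * M * (1 + c), by positivity, -Real.log ρ, neg_pos.2 (Real.log_neg hρ hρ1),
    fun yref wd x0 z0 T n => ?_⟩
  set v := sys.equilibrium ctrl wd.toL2 yref.toL2 with hv
  have h1 : T.e n - sys.asymptoticError ctrl wd.toL2 yref.toL2 =
      O ((sys.closedLoopOp ctrl ^ n) ((x0, z0) - v)) := by
    rw [T.error_formula, asymptoticError, add_sub_add_right_eq_sub, ← map_sub,
      affine_iterate_sub_fixedPoint T.lifted_succ (hfix wd.toL2 yref.toL2) n, T.lifted_zero]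
  have h2 : ‖(x0, z0) - v‖ ≤ (1 + c) * (‖x0‖ + ‖z0‖ + ‖yref.toL2‖ + ‖wd.toL2‖) := by
    have h3 := (norm_sub_le (x0, z0) v).trans
      (add_le_add (norm_prod_le_add x0 z0) (hbd wd.toL2 yref.toL2))
    have h4 : 0 ≤ c * (‖x0‖ + ‖z0‖) := by positivity
    linarith [norm_nonneg yref.toL2, norm_nonneg wd.toL2]
  rw [h1, exp_neg_neg_log_mul hρ]
  calc ‖O ((sys.closedLoopOp ctrl ^ n) ((x0, z0) - v))‖
      ≤ ‖O‖ * ‖(sys.closedLoopOp ctrl ^ n) ((x0, z0) - v)‖ := O.le_opNorm _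
    _ ≤ (‖O‖ + 1) * (M * ρ ^ n *
        ((1 + c) * (‖x0‖ + ‖z0‖ + ‖yref.toL2‖ + ‖wd.toL2‖))) := by
      gcongr
      · linarith
      · exact (hpow n _).trans (mul_le_mul_of_nonneg_left h2 (by positivity))
    _ = _ := by ring

/-- The internal model `G₁ = I` forces the asymptotic error into the kernel of `G₂`. -/
theorem G₂_asymptoticError [CompleteSpace Z] (h : PowerStable (sys.closedLoopOp ctrl))
    (hG₁ : ctrl.G₁ = ContinuousLinearMap.id ℂ Z) (w : L2 τ Ud₀) (y : L2 τ Y₀) :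
    ctrl.G₂ (sys.asymptoticError ctrl w y) = 0 := by
  have h1 := congrArg Prod.snd (equilibrium_eq h w y)
  rw [closedLoopOp_add_forcing_snd, hG₁] at h1
  exact left_eq_add.1 h1

/-- The first component of the fixed-point equation determines the plant state from the control and
the disturbance; inserting it in the output produces `𝒫` and `𝒫_d`. -/
theorem asymptoticError_eq [CompleteSpace Z] (h : PowerStable (sys.closedLoopOp ctrl))
    (hE : IsUnit (1 - sys.evol τ 0)) (w : L2 τ Ud₀) (y : L2 τ Y₀) :
    sys.asymptoticError ctrl w y =
      sys.P (ctrl.K (sys.equilibrium ctrl w y).2) + sys.Pd w - y := by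
  have h1 := congrArg Prod.fst (equilibrium_eq h w y)
  rw [closedLoopOp_add_forcing_fst] at h1
  have h2 := PeriodicEvolutionFamily.monodromyResolvent_eq_of_isUnit hE h1
  have h3 : sys.closedLoopOutput ctrl (sys.equilibrium ctrl w y) =
      sys.outputOp (sys.equilibrium ctrl w y).1 +
        sys.feedthroughOp (ctrl.K (sys.equilibrium ctrl w y).2) := rfl
  rw [asymptoticError, h3, h2, P_apply, Pd_apply, exoError, map_add, map_add]
  abel

/-- Such a `z`, paired with the periodic plant state that it drives, is a fixed point of the
closed-loop operator, and power stability leaves only zero. -/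
theorem eq_zero_of_G₂_P_K_eq_zero [CompleteSpace Z] (h : PowerStable (sys.closedLoopOp ctrl))
    (hE : IsUnit (1 - sys.evol τ 0)) (hG₁ : ctrl.G₁ = ContinuousLinearMap.id ℂ Z) {z : Z}
    (hz : ctrl.G₂ (sys.P (ctrl.K z)) = 0) : z = 0 := by
  set x := sys.monodromyResolvent (sys.inputOp (ctrl.K z)) with hx
  have h1 : x = sys.evol τ 0 x + sys.inputOp (ctrl.K z) :=
    PeriodicEvolutionFamily.monodromyResolvent_apply_eq hE _
  have h2 : (1 - sys.closedLoopOp ctrl) (x, z) = 0 := by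
    rw [P_apply, ← hx] at hz
    rw [sub_apply, one_apply_eq_self, sub_eq_zero]
    refine Prod.ext h1 ?_
    simp only [closedLoopOp, blockOp_apply, hG₁, add_apply, ContinuousLinearMap.comp_apply,
      ContinuousLinearMap.id_apply]
    rw [add_left_comm, ← map_add, hz, add_zero]
  have h3 := congrArg (fun A => A (x, z)) (Ring.inverse_mul_cancel _ h.isUnit_one_sub)
  simp only [mul_apply_eq_comp, one_apply_eq_self, h2, map_zero] at h3
  exact (congrArg Prod.snd h3).symm

/-- The controller part of the equilibrium solves the equation, and injectivity of `G₂ 𝒫 K` gives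
uniqueness. Of `G₂` only the kernel matters, which is that of `Q`. -/
theorem hasApproximateRegulationError [CompleteSpace Z] (h : PowerStable (sys.closedLoopOp ctrl))
    (hE : IsUnit (1 - sys.evol τ 0)) (hG₁ : ctrl.G₁ = ContinuousLinearMap.id ℂ Z)
    {YN : Submodule ℂ (L2 τ Y₀)} {Q : L2 τ Y₀ →L[ℂ] YN} (hG₂ : ∀ y, ctrl.G₂ y = 0 ↔ Q y = 0) :
    HasApproximateRegulationError sys ctrl Q := by
  have hQ : ∀ w y, Q (sys.asymptoticError ctrl w y) = 0 := fun w y =>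
    (hG₂ _).1 (G₂_asymptoticError h hG₁ w y)
  have hsol : ∀ w y, Q (sys.P (ctrl.K (sys.equilibrium ctrl w y).2)) = Q y - Q (sys.Pd w) := by
    intro w y
    have h1 := hQ w y
    rw [asymptoticError_eq h hE, map_sub, map_add] at h1
    rw [eq_sub_iff_add_eq, ← sub_eq_zero]
    exact h1
  refine ⟨fun yref wd => (sys.equilibrium ctrl wd.toL2 yref.toL2).2, fun yref wd z => ⟨fun hz => ?_,
    fun hz => ?_⟩, ?_⟩
  · rw [← hsol, ← sub_eq_zero, ← map_sub, ← map_sub, ← map_sub, ← hG₂] at hz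
    exact sub_eq_zero.1 (eq_zero_of_G₂_P_K_eq_zero h hE hG₁ hz)
  · rw [hz, hsol]
  · convert errorConvergesTo_asymptoticError h using 3 with yref wd
    -- Since `Q` annihilates the limit error, `I - Q` leaves it unchanged.
    rw [← asymptoticError_eq h hE, sub_apply, ContinuousLinearMap.comp_apply, hQ, map_zero,
      sub_zero, ContinuousLinearMap.id_apply]

end PeriodicSystem

end ClosedLoopStability

/-! ### The main theorem -/

theorem mainTheorem4 {τ : ℝ} {X U₀ Ud₀ Y₀ : Type*}
    [NormedAddCommGroup X] [NormedSpace ℂ X] [CompleteSpace X]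
    [NormedAddCommGroup U₀] [InnerProductSpace ℂ U₀] [CompleteSpace U₀]
    [NormedAddCommGroup Ud₀] [InnerProductSpace ℂ Ud₀] [CompleteSpace Ud₀]
    [NormedAddCommGroup Y₀] [InnerProductSpace ℂ Y₀] [CompleteSpace Y₀]
    (sys : PeriodicSystem τ X U₀ Ud₀ Y₀) (hsys : sys.ExponentiallyStable)
    (YN : Submodule ℂ (L2 τ Y₀)) [FiniteDimensional ℂ YN] (r : ℕ) (hr : r = Module.finrank ℂ YN)
    (hYN : YN ≤ LinearMap.range (sys.P : L2 τ U₀ →ₗ[ℂ] L2 τ Y₀))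
    (QN : L2 τ Y₀ →L[ℂ] YN) (hQN : ∀ y : YN, QN y = y)
    (G₂₀ : YN ≃L[ℂ] EuclideanSpace ℂ (Fin r))
    (K₀ : EuclideanSpace ℂ (Fin r) →L[ℂ] L2 τ U₀)
    (hK₀ : ∀ μ ∈ spectrum ℂ (((G₂₀ : YN →L[ℂ] EuclideanSpace ℂ (Fin r)) ∘L QN) ∘L sys.P ∘L K₀),
      μ.re < 0) :
    ∃ εstar : ℝ, 0 < εstar ∧ ∀ ε : ℝ, 0 < ε → ε ≤ εstar →
      ∀ ctrl : Controller τ U₀ Y₀ (EuclideanSpace ℂ (Fin r)),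
        ctrl = { G₁ := ContinuousLinearMap.id ℂ (EuclideanSpace ℂ (Fin r))
                 G₂ := (G₂₀ : YN →L[ℂ] EuclideanSpace ℂ (Fin r)) ∘L QN
                 K := (ε : ℂ) • K₀ } →
        -- the nominal closed loop: well-posedness, stability, and asymptotic error
        (ClosedLoopWellPosed sys ctrl ∧ ClosedLoopStable sys ctrl ∧
          HasApproximateRegulationError sys ctrl QN) ∧
        -- robustness: perturbed systems for which the closed loop is still exponentially stable
        (∀ sys' : PeriodicSystem τ X U₀ Ud₀ Y₀, ClosedLoopStable sys' ctrl →
          ClosedLoopWellPosed sys' ctrl ∧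
          (∃ err : PeriodicSignal τ Y₀ → PeriodicSignal τ Ud₀ → L2 τ Y₀,
            (∀ yref wd, QN (err yref wd) = 0) ∧ ErrorConvergesTo sys' ctrl err) ∧
          ((1 : ℂ) ∈ resolventSet ℂ (sys'.evol τ 0) →
            HasApproximateRegulationError sys' ctrl QN)) := by
  have hT : PowerStable (sys.evol τ 0) :=
    PeriodicEvolutionFamily.ExponentiallyStable.powerStable hsys
  set G₂ : L2 τ Y₀ →L[ℂ] EuclideanSpace ℂ (Fin r) :=
    (G₂₀ : YN →L[ℂ] EuclideanSpace ℂ (Fin r)) ∘L QN with hG₂def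
  have hG₂ : ∀ y, G₂ y = 0 ↔ QN y = 0 := fun y => G₂₀.map_eq_zero_iff
  set L := sys.monodromyResolvent ∘L sys.inputOp ∘L K₀ with hLdef
  have hL : ∀ z, L z = sys.evol τ 0 (L z) + (sys.inputOp ∘L K₀) z := fun z =>
    PeriodicEvolutionFamily.monodromyResolvent_apply_eq hT.isUnit_one_sub _
  -- The transfer matrix at `1` in the low-gain theorem is the operator whose spectrum is assumed to
  -- lie in the open left half plane.
  have hS : (G₂ ∘L sys.outputOp) ∘L L + G₂ ∘L sys.feedthroughOp ∘L K₀ = G₂ ∘L sys.P ∘L K₀ := by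
    ext1 z
    simp only [hLdef, add_apply, ContinuousLinearMap.comp_apply, sys.P_apply, map_add]
  obtain ⟨εstar, hεstar, h⟩ := exists_powerStable_blockOp hT (sys.inputOp ∘L K₀) L
    (G₂ ∘L sys.outputOp) (G₂ ∘L sys.feedthroughOp ∘L K₀) hL (by rwa [hS])
  refine ⟨εstar, hεstar, fun ε hε hle ctrl hctrl => ?_⟩
  have hG₁ : ctrl.G₁ = ContinuousLinearMap.id ℂ _ := by rw [hctrl]
  have hG₂' : ∀ y, ctrl.G₂ y = 0 ↔ QN y = 0 := by rw [hctrl]; exact hG₂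
  have hpow : PowerStable (sys.closedLoopOp ctrl) := by
    have hop : sys.closedLoopOp ctrl = blockOp (sys.evol τ 0) ((ε : ℂ) • (sys.inputOp ∘L K₀))
        (G₂ ∘L sys.outputOp) (1 + (ε : ℂ) • (G₂ ∘L sys.feedthroughOp ∘L K₀)) := by
      simp only [PeriodicSystem.closedLoopOp, hctrl, ContinuousLinearMap.comp_smul,
        ContinuousLinearMap.one_def]
    rw [hop]
    exact h ε hε hle
  refine ⟨⟨closedLoopWellPosed sys ctrl, closedLoopStable_of_powerStable hpow,
    PeriodicSystem.hasApproximateRegulationError hpow hT.isUnit_one_sub hG₁ hG₂'⟩,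
    fun sys' hsys' => ?_⟩
  -- For the perturbed system power stability comes from the assumed decay alone, so no smallness of
  -- the perturbation enters.
  have hpow' := powerStable_of_closedLoopStable hsys'
  refine ⟨closedLoopWellPosed sys' ctrl, ⟨_, fun yref wd => ?_,
    PeriodicSystem.errorConvergesTo_asymptoticError hpow'⟩, fun hres => ?_⟩
  · exact (hG₂' _).1 (PeriodicSystem.G₂_asymptoticError hpow' hG₁ _ _)
  · refine PeriodicSystem.hasApproximateRegulationError hpow' ?_ hG₁ hG₂'
    rwa [spectrum.mem_resolventSet_iff, map_one] at hres
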